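/- Let $K$ be a field of characteristic $0$. Let $G=\mathrm{GSp}_4=\{(g,\nu)\in \mathrm{GL}_4\times\mathbf{G}_m : {}^t g J g=\nu J\}$ over $K$, where $J$ is the antidiagonal matrix with entries $1,1,-1,-1$ from top right to bottom left, and let $H=\mathrm{GL}_2\times_{\mathrm{GL}_1}\mathrm{GL}_2=\{(h_1,h_2) : \det h_1=\det h_2\}$, embedded in $G$ by \[ \iota:\left[\begin{pmatrix} a & b\\ c& d\end{pmatrix},\begin{pmatrix} a' & b'\\ c'& d'\end{pmatrix}\right]\mapsto \begin{pmatrix} a&0&0&b\\0&a'&b'&0\\0&c'&d'&0\\c&0&0&d\end{pmatrix}. \] Let $r_1\ge r_2\ge 0$ and $t_1,t_2\ge 0$ be integers with $r_1+r_2+t_1+t_2$ even, and put \[(k_1,k_2)=(r_1+3,r_2+3),\qquad (c_1,c_2)=(t_1+2,t_2+2),\qquad w=\tfrac{k_1+k_2+c_1+c_2-6}{2}.\] Let $V^G_\lambda$ be the irreducible algebraic representation of $G$ whose highest weight, with respect to the upper-triangular Borel subgroup, is $\lambda=(r_1,r_2;r_1+r_2)$, i.e. the character $\mathrm{diag}(x,y,\nu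 y^{-1},\nu x^{-1})\mapsto x^{r_1}y^{r_2}$, and let $V^H_\mu$ be the irreducible algebraic representation of $H$ whose highest weight, with respect to the upper-triangular Borel subgroup, is $\mu=(t_1,t_2;t_1+t_2)$, i.e. the character $(\mathrm{diag}(x,\nu x^{-1}),\mathrm{diag}(y,\nu y^{-1}))\mapsto x^{t_1}y^{t_2}$. Write $\det$ for the character $(h_1,h_2)\mapsto\det h_1=\det h_2$ of $H$, and regard $V^G_\lambda$ as a representation of $H$ via $\iota$. Then \[ \mathrm{Hom}_H\big(V^G_\lambda\otimes V^H_\mu\otimes{\det}^{2-w},\mathrm{triv}\big)\neq 0 \] if and only if $(c_1,c_2)$ lies in region $(e)$, that is, \[ |c_1-c_2|\le k_1-k_2\quad\text{and}\quad k_1-k_2+4\le c_1+c_2\le k_1+k_2-2. \] -/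

import Mathlib

open Matrix
open scoped MatrixGroups

noncomputable section

/-- The antidiagonal symplectic form `J`. -/
def symplJ (K : Type*) [Field K] : Matrix (Fin 4) (Fin 4) K :=
  !![0, 0, 0, 1; 0, 0, 1, 0; 0, -1, 0, 0; -1, 0, 0, 0]

/-- The group `GSp₄(K)` of pairs `(g, ν)` in `GL₄(K) × Kˣ` with `ᵗg J g = ν J`. -/
def GSp4 (K : Type*) [Field K] : Subgroup (GL (Fin 4) K × Kˣ) where
  carrier := {x | (x.1 : Matrix (Fin 4) (Fin 4) K)ᵀ * symplJ K * (x.1 : Matrix (Fin 4) (Fin 4) K)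
    = (x.2 : K) • symplJ K}
  one_mem' := by simp
  mul_mem' := by
    intro a b ha hb
    simp only [Set.mem_ofPred_eq] at ha hb ⊢
    simp only [Prod.fst_mul, Prod.snd_mul, Units.val_mul, transpose_mul]
    calc (b.1 : Matrix (Fin 4) (Fin 4) K)ᵀ * (a.1 : Matrix (Fin 4) (Fin 4) K)ᵀ * symplJ K
          * ((a.1 : Matrix (Fin 4) (Fin 4) K) * (b.1 : Matrix (Fin 4) (Fin 4) K))
        = (b.1 : Matrix (Fin 4) (Fin 4) K)ᵀ * ((a.1 : Matrix (Fin 4) (Fin 4) K)ᵀ * symplJ K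
          * (a.1 : Matrix (Fin 4) (Fin 4) K)) * (b.1 : Matrix (Fin 4) (Fin 4) K) := by
            simp only [Matrix.mul_assoc]
      _ = ((a.2 : K) * (b.2 : K)) • symplJ K := by
            rw [ha, Matrix.mul_smul, Matrix.smul_mul, hb, smul_smul]
  inv_mem' := by
    intro a ha
    simp only [Set.mem_ofPred_eq] at ha ⊢
    have h1 : (a.1 : Matrix (Fin 4) (Fin 4) K) * ((a⁻¹).1 : Matrix (Fin 4) (Fin 4) K) = 1 := by
      simp
    have h2 : ((a⁻¹).1 : Matrix (Fin 4) (Fin 4) K)ᵀ * (a.1 : Matrix (Fin 4) (Fin 4) K)ᵀ = 1 := by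
      rw [← transpose_mul, h1, transpose_one]
    have h3 : ((a⁻¹).2 : K) * (a.2 : K) = 1 := by simp
    generalize ((a⁻¹).1 : Matrix (Fin 4) (Fin 4) K) = b at h1 h2 ⊢
    generalize ((a⁻¹).2 : K) = n at h3 ⊢
    calc bᵀ * symplJ K * b = (n * (a.2 : K)) • (bᵀ * symplJ K * b) := by rw [h3, one_smul]
      _ = n • (bᵀ * ((a.2 : K) • symplJ K) * b) := by
            rw [Matrix.mul_smul, Matrix.smul_mul, smul_smul]
      _ = n • ((bᵀ * (a.1 : Matrix (Fin 4) (Fin 4) K)ᵀ) * symplJ K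
            * ((a.1 : Matrix (Fin 4) (Fin 4) K) * b)) := by
            rw [← ha]; simp only [Matrix.mul_assoc]
      _ = n • symplJ K := by rw [h1, h2, Matrix.one_mul, Matrix.mul_one]

/-- The group `H(K)` of pairs of elements of `GL₂(K)` with the same determinant. -/
def GL2xGL2 (K : Type*) [Field K] : Subgroup (GL (Fin 2) K × GL (Fin 2) K) where
  carrier := {h | GeneralLinearGroup.det h.1 = GeneralLinearGroup.det h.2}
  one_mem' := by simp
  mul_mem' := by
    intro a b ha hb
    simp only [Set.mem_ofPred_eq] at ha hb ⊢
    simp [ha, hb]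
  inv_mem' := by
    intro a ha
    simp only [Set.mem_ofPred_eq] at ha ⊢
    simp [ha]

/-- The `4 × 4` matrix with outer block `x` and inner block `y`. -/
def iotaMat {K : Type*} [Field K] (x y : Matrix (Fin 2) (Fin 2) K) : Matrix (Fin 4) (Fin 4) K :=
  !![x 0 0, 0, 0, x 0 1;
     0, y 0 0, y 0 1, 0;
     0, y 1 0, y 1 1, 0;
     x 1 0, 0, 0, x 1 1]

theorem iotaMat_mul {K : Type*} [Field K] (x y x' y' : Matrix (Fin 2) (Fin 2) K) :
    iotaMat (x * x') (y * y') = iotaMat x y * iotaMat x' y' := by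
  ext i j
  fin_cases i <;> fin_cases j <;>
    simp [iotaMat, Matrix.mul_apply, Fin.sum_univ_succ]

theorem iotaMat_one {K : Type*} [Field K] : iotaMat (1 : Matrix (Fin 2) (Fin 2) K) 1 = 1 := by
  ext i j
  fin_cases i <;> fin_cases j <;> simp [iotaMat]

theorem iotaMat_form {K : Type*} [Field K] (x y : Matrix (Fin 2) (Fin 2) K) (h : x.det = y.det) :
    (iotaMat x y)ᵀ * symplJ K * iotaMat x y = x.det • symplJ K := by
  have h' := h
  rw [det_fin_two, det_fin_two] at h'
  rw [det_fin_two]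
  ext i j
  fin_cases i <;> fin_cases j <;>
    simp [iotaMat, symplJ, Matrix.mul_apply, Fin.sum_univ_succ] <;> grind

/-- The embedding of `H(K)` in `GSp₄(K)`. -/
def iota (K : Type*) [Field K] : GL2xGL2 K →* GSp4 K where
  toFun h :=
    ⟨(⟨iotaMat h.1.1 h.1.2, iotaMat (h.1.1⁻¹ : GL (Fin 2) K) (h.1.2⁻¹ : GL (Fin 2) K),
        by rw [← iotaMat_mul]; simp [iotaMat_one], by rw [← iotaMat_mul]; simp [iotaMat_one]⟩,
      GeneralLinearGroup.det h.1.1), by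
        have hdet := congrArg Units.val h.2
        exact iotaMat_form _ _ hdet⟩
  map_one' := by
    apply Subtype.ext
    apply Prod.ext
    · apply Units.ext
      simp [iotaMat_one]
    · simp
  map_mul' a b := by
    apply Subtype.ext
    apply Prod.ext
    · apply Units.ext
      simp [iotaMat_mul]
    · simp

/-- A finite-dimensional representation is algebraic with respect to a family `coord` of
generators of the ring of regular functions if all its matrix coefficients are polynomials in
these generators. -/
def IsAlgebraicRep {K Γ σ V : Type*} [Field K] [Group Γ] [AddCommGroup V] [Module K V]
    (coord : Γ → σ → K) (ρ : Representation K Γ V) : Prop :=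
  FiniteDimensional K V ∧
    ∀ (φ : V →ₗ[K] K) (v : V), ∃ P : MvPolynomial σ K,
      ∀ g : Γ, φ (ρ g v) = MvPolynomial.eval (coord g) P

/-- Generators of the coordinate ring of `GSp₄`: the matrix entries, `ν` and `ν⁻¹`. -/
def GSp4.coord {K : Type*} [Field K] (g : GSp4 K) : (Fin 4 × Fin 4) ⊕ Bool → K
  | .inl ij => (g.1.1 : Matrix (Fin 4) (Fin 4) K) ij.1 ij.2
  | .inr true => (g.1.2 : K)
  | .inr false => ((g.1.2⁻¹ : Kˣ) : K)

/-- Generators of the coordinate ring of `H`: the entries of both matrices and the inverse of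
the common determinant. -/
def GL2xGL2.coord {K : Type*} [Field K] (h : GL2xGL2 K) :
    ((Fin 2 × Fin 2) ⊕ (Fin 2 × Fin 2)) ⊕ Unit → K
  | .inl (.inl ij) => (h.1.1 : Matrix (Fin 2) (Fin 2) K) ij.1 ij.2
  | .inl (.inr ij) => (h.1.2 : Matrix (Fin 2) (Fin 2) K) ij.1 ij.2
  | .inr _ => (((GeneralLinearGroup.det h.1.1)⁻¹ : Kˣ) : K)

/-- `ρ` is the irreducible algebraic representation of `GSp₄` whose highest weight, with respect
to the upper-triangular Borel subgroup, is `(r₁, r₂; r₁ + r₂)`, that is, the character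
`diag(x, y, ν / y, ν / x) ↦ x ^ r₁ * y ^ r₂`. On the centre this is `z ↦ z ^ (r₁ + r₂)`. -/
def GSp4.IsHighestWeightRep {K V : Type*} [Field K] [AddCommGroup V] [Module K V]
    (ρ : Representation K (GSp4 K) V) (r₁ r₂ : ℕ) : Prop :=
  IsAlgebraicRep GSp4.coord ρ ∧ ρ.IsIrreducible ∧
    ∃ v : V, v ≠ 0 ∧ ∀ b : GSp4 K,
      (b.1.1 : Matrix (Fin 4) (Fin 4) K).BlockTriangular id →
        ρ b v = ((b.1.1 : Matrix (Fin 4) (Fin 4) K) 0 0 ^ r₁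
          * (b.1.1 : Matrix (Fin 4) (Fin 4) K) 1 1 ^ r₂) • v

/-- `σ` is the irreducible algebraic representation of `H` whose highest weight, with respect
to the upper-triangular Borel subgroup, is `(t₁, t₂; t₁ + t₂)`, that is, the character
`(diag(x, ν / x), diag(y, ν / y)) ↦ x ^ t₁ * y ^ t₂`. On the central elements `(z, z)` this is
`z ↦ z ^ (t₁ + t₂)`. -/
def GL2xGL2.IsHighestWeightRep {K V : Type*} [Field K] [AddCommGroup V] [Module K V]
    (σ : Representation K (GL2xGL2 K) V) (t₁ t₂ : ℕ) : Prop :=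
  IsAlgebraicRep GL2xGL2.coord σ ∧ σ.IsIrreducible ∧
    ∃ v : V, v ≠ 0 ∧ ∀ b : GL2xGL2 K,
      (b.1.1 : Matrix (Fin 2) (Fin 2) K).BlockTriangular id →
      (b.1.2 : Matrix (Fin 2) (Fin 2) K).BlockTriangular id →
        σ b v = ((b.1.1 : Matrix (Fin 2) (Fin 2) K) 0 0 ^ t₁
          * (b.1.2 : Matrix (Fin 2) (Fin 2) K) 0 0 ^ t₂) • v

/-- The one-dimensional representation `det ^ n` of `H`, for an integer `n`, where `det` is the
common determinant of the two components. -/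
def GL2xGL2.detPow (K : Type*) [Field K] (n : ℤ) : Representation K (GL2xGL2 K) K where
  toFun h := ((GeneralLinearGroup.det h.1.1 ^ n : Kˣ) : K) • LinearMap.id
  map_one' := by ext; simp
  map_mul' a b := by
    ext
    simp [mul_zpow, mul_comm]

/-- Region `(e)` of the diagram of weights `(c₁, c₂)` attached to `(k₁, k₂)`. -/
def RegionE (k₁ k₂ c₁ c₂ : ℤ) : Prop :=
  |c₁ - c₂| ≤ k₁ - k₂ ∧ k₁ - k₂ + 4 ≤ c₁ + c₂ ∧ c₁ + c₂ ≤ k₁ + k₂ - 2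

end

/-! The group `H` is spherical in `G`: its Borel subgroup has an open orbit on the four-dimensional
flag variety of `G`. Evaluating an invariant functional at the highest weight vector of `V^H` gives
a functional `φ` on `V^G` that is semi-invariant under this Borel subgroup
(`exists_semiinvariant_of_intertwining`). Irreducibility of `V^G` means that `φ` is determined by
the function `g ↦ φ (ρ g v)`, with `v` a highest weight vector, and the open orbit determines this
function up to a scalar.

The complement of the open orbit is cut out by four semi-invariants: the entries `g₃₀`, `g₂₀` and
the minors `m₂₃`, `m₀₃` of the first two columns. So the function must be a constant times `g₃₀^nA
g₂₀^nB m₂₃^nC m₀₃^nD`, and the weights force `nA + nC = t₁`, `nB + nC = t₂`, `nA + nB = r₁ - r₂`,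
`nC + nD = r₂`. Regularity forces the exponents to be nonnegative (`weight_of_semiinvariant`), and
these four inequalities are region (e).

Conversely, nonnegative exponents make the monomial a matrix coefficient of `v`
(`exists_semiInv_functional`). This case of Borel–Weil is obtained by hand: the lowest weight
functional has coefficient `g₀₀^(r₁-r₂) m₀₁^r₂`, and an orthogonal projection over `ℚ` writes the
monomial as a combination of its translates. Translating the resulting functional by `H` gives
functions bihomogeneous of degree `(t₁, t₂)` in the first columns, which are the matrix coefficients
of `V^H`; this defines the invariant pairing (`exists_intertwining`).

Zariski density is replaced throughout by one-variable polynomial arguments along unipotent curves.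
-/

theorem Representation.IsIrreducible.span_orbit_eq_top {K Γ V : Type*} [Field K] [Group Γ]
    [AddCommGroup V] [Module K V] {ρ : Representation K Γ V} (h : ρ.IsIrreducible)
    {v : V} (hv : v ≠ 0) : Submodule.span K (Set.range fun g => ρ g v) = ⊤ := by
  let S : Subrepresentation ρ :=
    { toSubmodule := Submodule.span K (Set.range fun g => ρ g v)
      apply_mem_toSubmodule := by
        intro g w hw
        induction hw using Submodule.span_induction with
        | mem x hx =>
          obtain ⟨k, rfl⟩ := hx
          exact Submodule.subset_span ⟨g * k, by simp⟩
        | zero => simp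
        | add x y _ _ hx hy => rw [map_add]; exact add_mem hx hy
        | smul c x _ hx => rw [map_smul]; exact Submodule.smul_mem _ _ hx }
  have hS : v ∈ S.toSubmodule := Submodule.subset_span ⟨1, by simp⟩
  rcases h.eq_bot_or_eq_top S with h0 | h0
  · rw [h0] at hS
    exact absurd ((Submodule.mem_bot K).1 hS) hv
  · change S.toSubmodule = ⊤
    rw [h0]; rfl

/-- Matrix coefficients along a family of group elements lie in every algebra of functions that
contains the coordinates of the family. -/
theorem IsAlgebraicRep.coeff_mem {K Γ σ V Z : Type*} [Field K] [Group Γ] [AddCommGroup V]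
    [Module K V] {coord : Γ → σ → K} {ρ : Representation K Γ V} (h : IsAlgebraicRep coord ρ)
    (F : Subalgebra K (Z → K)) (γ : Z → Γ) (hγ : ∀ i, (fun z => coord (γ z) i) ∈ F)
    (φ : V →ₗ[K] K) (v : V) : (fun z => φ (ρ (γ z) v)) ∈ F := by
  obtain ⟨P, hP⟩ := h.2 φ v
  have key : (fun z => φ (ρ (γ z) v)) = MvPolynomial.aeval (fun i z => coord (γ z) i) P := by
    funext z
    rw [hP]
    clear hP
    induction P using MvPolynomial.induction_on with
    | C a => simp
    | add p q hp hq => simp_all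
    | mul_X p i hp => simp_all
  rw [key]
  let y : σ → F := fun i => ⟨_, hγ i⟩
  have e : (fun i z => coord (γ z) i) = fun i => F.val (y i) := rfl
  rw [e, ← MvPolynomial.comp_aeval_apply]
  exact Subtype.property _

/-! ### Polynomial and Laurent polynomial functions; orthogonal projection. -/

/-- Polynomial functions of one variable. -/
noncomputable def polyFun (K : Type*) [Field K] : Subalgebra K (K → K) :=
  (Polynomial.aeval (id : K → K)).range

theorem mem_polyFun {K : Type*} [Field K] {f : K → K} :
    f ∈ polyFun K ↔ ∃ p : Polynomial K, ∀ s, f s = p.eval s := by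
  have key : ∀ (p : Polynomial K) (s : K), Polynomial.aeval (id : K → K) p s = p.eval s := by
    intro p s
    induction p using Polynomial.induction_on' with
    | add p q hp hq => simp_all
    | monomial n a => simp [Polynomial.aeval_monomial]
  constructor
  · rintro ⟨p, rfl⟩
    exact ⟨p, fun s => key p s⟩
  · rintro ⟨p, hp⟩
    exact ⟨p, funext fun s => (key p s).trans (hp s).symm⟩

theorem id_mem_polyFun (K : Type*) [Field K] : (fun s : K => s) ∈ polyFun K :=
  mem_polyFun.2 ⟨Polynomial.X, by simp⟩

theorem const_mem_subalgebra {K Z : Type*} [Field K] (F : Subalgebra K (Z → K)) (a : K) :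
    (fun _ : Z => a) ∈ F := F.algebraMap_mem a

/-- Polynomial functions in finitely many variables. -/
noncomputable def mvPolyFun (K ι : Type*) [Field K] : Subalgebra K ((ι → K) → K) :=
  (MvPolynomial.aeval (fun i (z : ι → K) => z i)).range

theorem mem_mvPolyFun {K ι : Type*} [Field K] {f : (ι → K) → K} :
    f ∈ mvPolyFun K ι ↔ ∃ p : MvPolynomial ι K, ∀ s, f s = MvPolynomial.eval s p := by
  have key : ∀ (p : MvPolynomial ι K) (s : ι → K),
      MvPolynomial.aeval (fun i (z : ι → K) => z i) p s = MvPolynomial.eval s p := by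
    intro p s
    induction p using MvPolynomial.induction_on with
    | C a => simp
    | add p q hp hq => simp_all
    | mul_X p i hp => simp_all
  constructor
  · rintro ⟨p, rfl⟩
    exact ⟨p, fun s => key p s⟩
  · rintro ⟨p, hp⟩
    exact ⟨p, funext fun s => (key p s).trans (hp s).symm⟩

theorem coord_mem_mvPolyFun {K ι : Type*} [Field K] (i : ι) :
    (fun z : ι → K => z i) ∈ mvPolyFun K ι :=
  mem_mvPolyFun.2 ⟨MvPolynomial.X i, by simp⟩

/-- Polynomial functions over an infinite field form a domain. This extends identities from the
complement of a zero set to the whole line. -/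
theorem polyFun_eq_zero_of_mul {K : Type*} [Field K] [Infinite K] {f g : K → K}
    (hf : f ∈ polyFun K) (hg : g ∈ polyFun K) (h : ∀ s, f s * g s = 0) {s₀ : K}
    (h0 : g s₀ ≠ 0) (s : K) : f s = 0 := by
  obtain ⟨p, hp⟩ := mem_polyFun.1 hf
  obtain ⟨q, hq⟩ := mem_polyFun.1 hg
  have : p * q = 0 := Polynomial.funext fun s => by simp [← hp, ← hq, h]
  rcases mul_eq_zero.1 this with h1 | h1
  · simp [hp, h1]
  · exact absurd (by simp [hq, h1]) h0

theorem exists_ne_zero_of_polyFun {K : Type*} [Field K] [Infinite K] {f g : K → K}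
    (hf : f ∈ polyFun K) (hg : g ∈ polyFun K) {s₀ s₁ : K} (h0 : f s₀ ≠ 0) (h1 : g s₁ ≠ 0) :
    ∃ s, f s ≠ 0 ∧ g s ≠ 0 := by
  by_contra! hc
  refine h0 (polyFun_eq_zero_of_mul hf hg (fun s => ?_) h1 s₀)
  by_cases h : f s = 0
  · simp [h]
  · simp [hc s h]

/-- A negative exponent would be a pole at `0`: multiplying by `s ^ (-n)` would give a polynomial
equal to `c` off `0` but vanishing at `0`. -/
theorem exponent_nonneg_of_mem_polyFun {K : Type*} [Field K] [Infinite K] {f : K → K}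
    (hf : f ∈ polyFun K) {c : K} (hc : c ≠ 0) {n : ℤ} (h : ∀ s, s ≠ 0 → f s = c * s ^ n) :
    0 ≤ n := by
  by_contra! hn
  obtain ⟨k, hk⟩ : ∃ k : ℕ, n = -((k : ℤ) + 1) := ⟨(-n - 1).toNat, by omega⟩
  have h1 : (fun s => f s * s ^ (k + 1) - c) ∈ polyFun K :=
    sub_mem (mul_mem hf (pow_mem (id_mem_polyFun K) _)) (const_mem_subalgebra _ c)
  have := polyFun_eq_zero_of_mul h1 (id_mem_polyFun K) (s₀ := 1) (fun s => by
    by_cases hs : s = 0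
    · simp [hs]
    · have : s ^ n * s ^ (k + 1) = 1 := by
        rw [hk, _root_.zpow_neg, ← Nat.cast_succ, zpow_natCast]
        exact inv_mul_cancel₀ (pow_ne_zero _ hs)
      rw [h s hs, mul_assoc, this]; simp) one_ne_zero 0
  simp [hc] at this

/-- Laurent polynomial functions on `Kˣ`. -/
noncomputable def laurentFun (K : Type*) [Field K] : Subalgebra K (Kˣ → K) where
  carrier := {f | ∃ (D : ℕ) (p : Polynomial K), ∀ z : Kˣ, (z : K) ^ D * f z = p.eval (z : K)}
  mul_mem' := by
    rintro f g ⟨D, p, hp⟩ ⟨E, q, hq⟩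
    refine ⟨D + E, p * q, fun z => ?_⟩
    rw [Polynomial.eval_mul, ← hp, ← hq, Pi.mul_apply]; ring
  add_mem' := by
    rintro f g ⟨D, p, hp⟩ ⟨E, q, hq⟩
    refine ⟨D + E, Polynomial.X ^ E * p + Polynomial.X ^ D * q, fun z => ?_⟩
    simp only [Polynomial.eval_add, Polynomial.eval_mul, Polynomial.eval_pow, Polynomial.eval_X]
    rw [← hp, ← hq, Pi.add_apply]; ring
  algebraMap_mem' a := ⟨0, Polynomial.C a, fun z => by simp⟩

theorem val_mem_laurentFun (K : Type*) [Field K] : (fun z : Kˣ => (z : K)) ∈ laurentFun K :=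
  ⟨0, Polynomial.X, by simp⟩

theorem inv_mem_laurentFun (K : Type*) [Field K] : (fun z : Kˣ => ((z⁻¹ : Kˣ) : K)) ∈ laurentFun K :=
  ⟨1, 1, by simp⟩

theorem Polynomial.eq_of_eval_units {K : Type*} [Field K] [Infinite K] {p q : Polynomial K}
    (h : ∀ z : Kˣ, p.eval (z : K) = q.eval (z : K)) : p = q := by
  have : Polynomial.X * p = Polynomial.X * q := Polynomial.funext fun s => by
    by_cases hs : s = 0
    · simp [hs]
    · simpa [hs] using h (Units.mk0 s hs)
  exact mul_left_cancel₀ Polynomial.X_ne_zero this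

/-- The coefficient of `z ^ n` of a family of functionals depending on `z` as a Laurent
polynomial is a functional. -/
theorem exists_laurent_coeff {K W : Type*} [Field K] [Infinite K] [AddCommGroup W] [Module K W]
    (A : Kˣ → W →ₗ[K] K) (hA : ∀ w, (fun z => A z w) ∈ laurentFun K) (n : ℕ) :
    ∃ ψ : W →ₗ[K] K, ∀ w (D : ℕ) (p : Polynomial K),
      (∀ z : Kˣ, (z : K) ^ D * A z w = p.eval (z : K)) → ψ w = p.coeff (n + D) := by
  choose D p hp using hA
  -- The coefficient does not depend on the power of `z` used to clear denominators; linearity of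
  -- the chosen coefficients follows from this.
  have uniq : ∀ (f : Kˣ → K) (D E : ℕ) (p q : Polynomial K),
      (∀ z : Kˣ, (z : K) ^ D * f z = p.eval (z : K)) →
      (∀ z : Kˣ, (z : K) ^ E * f z = q.eval (z : K)) → p.coeff (n + D) = q.coeff (n + E) := by
    intro f D E p q h1 h2
    have : p * Polynomial.X ^ E = q * Polynomial.X ^ D := Polynomial.eq_of_eval_units fun z => by
      simp only [Polynomial.eval_mul, Polynomial.eval_pow, Polynomial.eval_X]
      rw [← h1, ← h2]; ring
    rw [← Polynomial.coeff_mul_X_pow p E, ← Polynomial.coeff_mul_X_pow q D, this]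
    congr 1; ring
  refine ⟨{ toFun := fun w => (p w).coeff (n + D w), map_add' := ?_, map_smul' := ?_ }, ?_⟩
  · intro w w'
    have := uniq (fun z => A z (w + w')) _ (D w + D w') _
      (p w * Polynomial.X ^ (D w') + p w' * Polynomial.X ^ (D w)) (hp _) (fun z => by
        simp only [Polynomial.eval_mul, Polynomial.eval_pow, Polynomial.eval_X,
          Polynomial.eval_add]
        rw [← hp, ← hp, map_add]; ring)
    rw [this, Polynomial.coeff_add, ← add_assoc, Polynomial.coeff_mul_X_pow,
      add_right_comm n, Polynomial.coeff_mul_X_pow]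
  · intro c w
    have := uniq (fun z => A z (c • w)) _ (D w) _ (Polynomial.C c * p w) (hp _) (fun z => by
        rw [Polynomial.eval_mul, Polynomial.eval_C, ← hp, map_smul, smul_eq_mul]; ring)
    rw [this, Polynomial.coeff_C_mul]; rfl
  · intro w E q hq
    exact uniq (fun z => A z w) _ _ _ _ (hp w) hq

/-- Over an ordered field, a linear functional restricted to a set of vectors is a combination of
dot products with vectors of the set. -/
theorem exists_dotProduct_combination {F X ι : Type*} [Field F] [LinearOrder F]
    [IsStrictOrderedRing F] [Fintype ι] (u : X → ι → F) (t : ι → F) :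
    ∃ c : X →₀ F, ∀ x, t ⬝ᵥ u x = c.sum fun y a => a * (u y ⬝ᵥ u x) := by
  classical
  let B : LinearMap.BilinForm F (ι → F) := dotProductBilin F F
  have hB : B.IsRefl := fun x y h => by
    simpa [B, dotProduct_comm] using h
  let S := Submodule.span F (Set.range u)
  -- Positive definiteness makes every subspace nondegenerate, so `t` can be projected orthogonally
  -- to the span of the vectors `u x`.
  have hS : (B.restrict S).Nondegenerate := by
    have : ∀ x : S, B.restrict S x x = 0 → x = 0 := fun x hx => by
      have : (x : ι → F) ⬝ᵥ (x : ι → F) = 0 := hx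
      exact Subtype.ext (dotProduct_self_eq_zero.1 this)
    constructor
    · exact fun x hx => this x (hx x)
    · exact fun x hx => this x (hx x)
  have hc := LinearMap.BilinForm.isCompl_orthogonal_of_restrict_nondegenerate hB hS
  obtain ⟨s, hs, s', hs', rfl⟩ := Submodule.mem_sup.1 (hc.sup_eq_top ▸ Submodule.mem_top (x := t))
  obtain ⟨c, rfl⟩ := (Finsupp.mem_span_range_iff_exists_finsupp).1 hs
  refine ⟨c, fun x => ?_⟩
  have h0 : s' ⬝ᵥ u x = 0 := by
    rw [dotProduct_comm]
    exact hs' (u x) (Submodule.subset_span ⟨x, rfl⟩)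
  rw [add_dotProduct, h0, add_zero, Finsupp.sum, Finsupp.sum, sum_dotProduct]
  simp

/-! ### Unipotent elements, torus and minors in `GSp₄`. -/

namespace GSp4

variable {K : Type*} [Field K]

/-- The matrix of an element of `GSp₄`. -/
def mat (g : GSp4 K) : Matrix (Fin 4) (Fin 4) K := g.1.1

@[simp] theorem mat_mul (g h : GSp4 K) : mat (g * h) = mat g * mat h := rfl

@[simp] theorem mat_one : mat (1 : GSp4 K) = 1 := rfl

theorem ext_mat {g h : GSp4 K} (h1 : mat g = mat h) (h2 : g.1.2 = h.1.2) : g = h :=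
  Subtype.ext (Prod.ext (Units.ext h1) h2)

theorem mat_form (g : GSp4 K) : (mat g)ᵀ * symplJ K * mat g = (g.1.2 : K) • symplJ K := g.2

theorem symplJ_mul_self : symplJ K * symplJ K = -1 := by
  ext i j
  fin_cases i <;> fin_cases j <;> simp [symplJ, Matrix.mul_apply, Fin.sum_univ_succ]

/-- The element of `GSp₄` with a given matrix and multiplier. -/
def ofMat (M : Matrix (Fin 4) (Fin 4) K) (ν : Kˣ) (h : Mᵀ * symplJ K * M = (ν : K) • symplJ K) :
    GSp4 K :=
  have h1 : (-((ν⁻¹ : Kˣ) : K) • (symplJ K * Mᵀ * symplJ K)) * M = 1 := by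
    rw [Matrix.smul_mul, Matrix.mul_assoc, Matrix.mul_assoc, ← Matrix.mul_assoc Mᵀ, h,
      Matrix.mul_smul, symplJ_mul_self, smul_smul]
    simp
  ⟨(⟨M, _, mul_eq_one_comm.1 h1, h1⟩, ν), h⟩

@[simp] theorem mat_ofMat (M : Matrix (Fin 4) (Fin 4) K) (ν : Kˣ)
    (h : Mᵀ * symplJ K * M = (ν : K) • symplJ K) : mat (ofMat M ν h) = M := rfl

/-- The lower unipotent matrices of `Sp₄`. -/
def lowMat (a b c d : K) : Matrix (Fin 4) (Fin 4) K :=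
  !![1, 0, 0, 0; a, 1, 0, 0; b, d, 1, 0; c, b - a * d, -a, 1]

/-- The lower unipotent elements of `Sp₄`. -/
def low (a b c d : K) : GSp4 K := ofMat (lowMat a b c d) 1 (by
  ext i j
  fin_cases i <;> fin_cases j <;>
    simp [lowMat, symplJ, Matrix.mul_apply, Fin.sum_univ_succ] <;> ring)

/-- The upper unipotent elements of `Sp₄`. -/
def up (a b c d : K) : GSp4 K := ofMat (lowMat a b c d)ᵀ 1 (by
  ext i j
  fin_cases i <;> fin_cases j <;>
    simp [lowMat, symplJ, Matrix.mul_apply, Fin.sum_univ_succ] <;> ring)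

@[simp] theorem mat_low (a b c d : K) : mat (low a b c d) = lowMat a b c d := rfl

@[simp] theorem mat_up (a b c d : K) : mat (up a b c d) = (lowMat a b c d)ᵀ := rfl

theorem low_zero : low (0 : K) 0 0 0 = 1 := by
  refine ext_mat ?_ rfl
  ext i j
  fin_cases i <;> fin_cases j <;> simp [lowMat]

theorem up_zero : up (0 : K) 0 0 0 = 1 := by
  refine ext_mat ?_ rfl
  ext i j
  fin_cases i <;> fin_cases j <;> simp [lowMat]

/-- The diagonal matrix `diag(1, z, z², z³)` with multiplier `z³`. -/
def torus (z : Kˣ) : GSp4 K := ofMat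
  !![1, 0, 0, 0; 0, (z : K), 0, 0; 0, 0, (z : K) ^ 2, 0; 0, 0, 0, (z : K) ^ 3] (z ^ 3) (by
  ext i j
  fin_cases i <;> fin_cases j <;>
    simp [symplJ, Matrix.mul_apply, Fin.sum_univ_succ] <;> ring)

theorem torus_mul_low (z : Kˣ) (a b c d : K) :
    torus z * low a b c d = low (z * a) (z ^ 2 * b) (z ^ 3 * c) (z * d) * torus z := by
  refine ext_mat ?_ (by simp [torus, low, ofMat])
  ext i j
  fin_cases i <;> fin_cases j <;>
    simp [torus, lowMat, Matrix.mul_apply, Fin.sum_univ_succ] <;> ring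

theorem coord_low_mem {Z : Type*} (F : Subalgebra K (Z → K)) {a b c d : Z → K} (ha : a ∈ F)
    (hb : b ∈ F) (hc : c ∈ F) (hd : d ∈ F) (i : (Fin 4 × Fin 4) ⊕ Bool) :
    (fun z => coord (low (a z) (b z) (c z) (d z)) i) ∈ F := by
  have h0 := const_mem_subalgebra F 0
  have h1 := const_mem_subalgebra F 1
  have h2 : (fun z => b z - a z * d z) ∈ F := sub_mem hb (mul_mem ha hd)
  have h3 : (fun z => - a z) ∈ F := neg_mem ha
  rcases i with ⟨i, j⟩ | i | i
  · fin_cases i <;> fin_cases j <;> assumption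
  · simpa [coord, low, ofMat] using h1
  · simpa [coord, low, ofMat] using h1

theorem coord_up_mem {Z : Type*} (F : Subalgebra K (Z → K)) {a b c d : Z → K} (ha : a ∈ F)
    (hb : b ∈ F) (hc : c ∈ F) (hd : d ∈ F) (i : (Fin 4 × Fin 4) ⊕ Bool) :
    (fun z => coord (up (a z) (b z) (c z) (d z)) i) ∈ F := by
  rcases i with ⟨i, j⟩ | i | i
  · exact coord_low_mem F ha hb hc hd (.inl (j, i))
  · simpa [coord, up, ofMat] using const_mem_subalgebra F 1
  · simpa [coord, up, ofMat] using const_mem_subalgebra F 1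

theorem coord_torus_mem (i : (Fin 4 × Fin 4) ⊕ Bool) :
    (fun z : Kˣ => coord (torus z) i) ∈ laurentFun K := by
  have h0 := const_mem_subalgebra (laurentFun K) 0
  have h1 := const_mem_subalgebra (laurentFun K) 1
  have hz := val_mem_laurentFun K
  have h2 := pow_mem hz 2
  have h3 := pow_mem hz 3
  have h4 := pow_mem (inv_mem_laurentFun K) 3
  rcases i with ⟨i, j⟩ | i | i
  · fin_cases i <;> fin_cases j <;> assumption
  · convert h4 using 2 with z
    simp [coord, torus, ofMat]
  · convert h3 using 2 with z
    simp [coord, torus, ofMat]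

/-- The minors of the first two columns. -/
def minor (g : GSp4 K) (i j : Fin 4) : K := mat g i 0 * mat g j 1 - mat g j 0 * mat g i 1

/-- The first two columns span an isotropic plane. -/
theorem minor_form (g : GSp4 K) : minor g 0 3 + minor g 1 2 = 0 := by
  have := congrFun (congrFun (mat_form g) 0) 1
  simp [symplJ, Matrix.mul_apply, Fin.sum_univ_succ] at this
  simp only [minor]
  linear_combination this

/-- By Cauchy–Binet, the upper left `2 × 2` minor of `g⁻¹ g = 1` is a combination of these minors.
-/
theorem not_forall_minor_eq_zero (g : GSp4 K) : ¬ ∀ i j, minor g i j = 0 := by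
  intro h
  have e : mat g⁻¹ * mat g = 1 := by rw [← mat_mul]; simp
  have key : ∀ p q r s : Fin 4 → K, (∑ i, p i * r i) * (∑ j, q j * s j)
      - (∑ j, q j * r j) * (∑ i, p i * s i) = ∑ i, ∑ j, p i * q j * (r i * s j - r j * s i) := by
    intro p q r s
    simp only [Fin.sum_univ_four]
    ring
  have := key (mat g⁻¹ 0) (mat g⁻¹ 1) (fun i => mat g i 0) (fun i => mat g i 1)
  simp only [← Matrix.mul_apply, e] at this
  simp only [minor] at h
  simp [h] at this

theorem exists_mat_ne_zero (g : GSp4 K) : ∃ i, mat g i 0 ≠ 0 := by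
  by_contra! h
  exact not_forall_minor_eq_zero g fun i j => by simp [minor, h]

/-- An element of `GSp₄` that preserves the line and the plane spanned by the first basis vectors
is upper triangular. -/
theorem blockTriangular_of_columns (b : GSp4 K) (h1 : ∀ i, i ≠ 0 → mat b i 0 = 0)
    (h2 : mat b 2 1 = 0) (h3 : mat b 3 1 = 0) : (mat b).BlockTriangular id := by
  have h4 : mat b 0 0 ≠ 0 := by
    obtain ⟨i, hi⟩ := exists_mat_ne_zero b
    by_cases h : i = 0
    · rwa [h] at hi
    · exact absurd (h1 i h) hi
  -- Orthogonality of columns `0` and `2` kills the one remaining entry below the diagonal, in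
  -- position `(3, 2)`.
  have h5 := congrFun (congrFun (mat_form b) 0) 2
  simp [symplJ, Matrix.mul_apply, Fin.sum_univ_succ, h1, h4] at h5
  intro i j hij
  fin_cases i <;> fin_cases j <;> simp_all

/-- The vector `ρ g v` depends only on the flag of the first two columns of `g`, up to the character
of the Borel subgroup: `g⁻¹ g'` is upper triangular with leading diagonal entries `l`, `m`. -/
theorem apply_of_columns {V : Type*} [AddCommGroup V] [Module K V] {ρ : Representation K (GSp4 K) V}
    {r₁ r₂ : ℕ} {v : V} (hv : ∀ b : GSp4 K, (b.1.1 : Matrix (Fin 4) (Fin 4) K).BlockTriangular id →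
        ρ b v = ((b.1.1 : Matrix (Fin 4) (Fin 4) K) 0 0 ^ r₁
          * (b.1.1 : Matrix (Fin 4) (Fin 4) K) 1 1 ^ r₂) • v)
    (g g' : GSp4 K) (l k m : K) (h0 : ∀ i, mat g' i 0 = l * mat g i 0)
    (h1 : ∀ i, mat g' i 1 = k * mat g i 0 + m * mat g i 1) :
    ρ g' v = (l ^ r₁ * m ^ r₂) • ρ g v := by
  obtain ⟨b, rfl⟩ : ∃ b, g' = g * b := ⟨g⁻¹ * g', by simp⟩
  have e : mat g⁻¹ * mat g = 1 := by rw [← mat_mul]; simp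
  have e0 : ∀ i, mat b i 0 = l * (1 : Matrix (Fin 4) (Fin 4) K) i 0 := fun i => by
    rw [← e, ← Matrix.one_mul (mat b), ← e, Matrix.mul_assoc, ← mat_mul g b, Matrix.mul_apply,
      Matrix.mul_apply, Finset.mul_sum]
    exact Finset.sum_congr rfl fun j _ => by rw [h0]; ring
  have e1 : ∀ i, mat b i 1 = k * (1 : Matrix (Fin 4) (Fin 4) K) i 0 +
      m * (1 : Matrix (Fin 4) (Fin 4) K) i 1 := fun i => by
    rw [← e, ← Matrix.one_mul (mat b), ← e, Matrix.mul_assoc, ← mat_mul g b, Matrix.mul_apply,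
      Matrix.mul_apply, Matrix.mul_apply, Finset.mul_sum, Finset.mul_sum, ← Finset.sum_add_distrib]
    exact Finset.sum_congr rfl fun j _ => by rw [h1]; ring
  have hb := hv b (blockTriangular_of_columns b (fun i hi => by rw [e0]; simp [hi])
    (by rw [e1]; simp) (by rw [e1]; simp))
  have b0 : mat b 0 0 = l := by rw [e0]; simp
  have b1 : mat b 1 1 = m := by rw [e1]; simp
  rw [map_mul, Module.End.mul_apply, hb, map_smul]
  change (mat b 0 0 ^ r₁ * mat b 1 1 ^ r₂) • _ = _
  rw [b0, b1]

end GSp4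

/-! ### Polynomiality along unipotent curves, and density of open sets. -/

namespace GSp4

variable {K : Type*} [Field K]

/-- Functions on `GSp₄` that are polynomial along translates of lines of unipotent elements. -/
def IsUnipotentPoly (f : GSp4 K → K) : Prop :=
  ∀ (g : GSp4 K) (a b c d : K),
    (fun s => f (low (s * a) (s * b) (s * c) (s * d) * g)) ∈ polyFun K ∧
    (fun s => f (up (s * a) (s * b) (s * c) (s * d) * g)) ∈ polyFun K

theorem mul_const_mem_polyFun (a : K) : (fun s => s * a) ∈ polyFun K :=
  mul_mem (id_mem_polyFun K) (const_mem_subalgebra _ a)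

namespace IsUnipotentPoly

theorem mul {f q : GSp4 K → K} (hf : IsUnipotentPoly f) (hq : IsUnipotentPoly q) :
    IsUnipotentPoly fun g => f g * q g :=
  fun g a b c d => ⟨mul_mem (hf g a b c d).1 (hq g a b c d).1,
    mul_mem (hf g a b c d).2 (hq g a b c d).2⟩

theorem sub {f q : GSp4 K → K} (hf : IsUnipotentPoly f) (hq : IsUnipotentPoly q) :
    IsUnipotentPoly fun g => f g - q g :=
  fun g a b c d => ⟨sub_mem (hf g a b c d).1 (hq g a b c d).1,
    sub_mem (hf g a b c d).2 (hq g a b c d).2⟩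

theorem pow {f : GSp4 K → K} (hf : IsUnipotentPoly f) (n : ℕ) :
    IsUnipotentPoly fun g => f g ^ n :=
  fun g a b c d => ⟨pow_mem (hf g a b c d).1 n, pow_mem (hf g a b c d).2 n⟩

theorem matrixCoeff {V : Type*} [AddCommGroup V] [Module K V] {ρ : Representation K (GSp4 K) V}
    (h : IsAlgebraicRep coord ρ) (φ : V →ₗ[K] K) (v : V) :
    IsUnipotentPoly fun g => φ (ρ g v) := by
  intro g a b c d
  simp only [map_mul, Module.End.mul_apply]
  have hs := mul_const_mem_polyFun (K := K)
  exact ⟨h.coeff_mem _ _ (coord_low_mem _ (hs a) (hs b) (hs c) (hs d)) φ _,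
    h.coeff_mem _ _ (coord_up_mem _ (hs a) (hs b) (hs c) (hs d)) φ _⟩

theorem entry (i j : Fin 4) : IsUnipotentPoly fun g : GSp4 K => mat g i j := by
  intro g a b c d
  have hs := mul_const_mem_polyFun (K := K)
  simp only [mat_mul, Matrix.mul_apply]
  have h1 := fun k => coord_low_mem _ (hs a) (hs b) (hs c) (hs d) (.inl (i, k))
  have h2 := fun k => coord_up_mem _ (hs a) (hs b) (hs c) (hs d) (.inl (i, k))
  constructor
  · convert sum_mem (t := Finset.univ)
      fun k _ => mul_mem (h1 k) (const_mem_subalgebra (polyFun K) (mat g k j)) using 1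
    funext s
    simp [mat, coord]
  · convert sum_mem (t := Finset.univ)
      fun k _ => mul_mem (h2 k) (const_mem_subalgebra (polyFun K) (mat g k j)) using 1
    funext s
    simp [mat, coord]

theorem minor (i j : Fin 4) : IsUnipotentPoly fun g : GSp4 K => minor g i j :=
  ((entry i 0).mul (entry j 1)).sub ((entry j 0).mul (entry i 1))

theorem entry_translate (w : GSp4 K) (i j : Fin 4) :
    IsUnipotentPoly fun g : GSp4 K => mat (w * g) i j := by
  intro g a b c d
  constructor
  · convert sum_mem (t := Finset.univ) fun k _ =>
      mul_mem (const_mem_subalgebra (polyFun K) (mat w i k)) (entry k j g a b c d).1 using 1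
    funext s
    change mat (w * (_ * g)) i j = _
    rw [mat_mul w, Matrix.mul_apply, Finset.sum_apply]
    rfl
  · convert sum_mem (t := Finset.univ) fun k _ =>
      mul_mem (const_mem_subalgebra (polyFun K) (mat w i k)) (entry k j g a b c d).2 using 1
    funext s
    change mat (w * (_ * g)) i j = _
    rw [mat_mul w, Matrix.mul_apply, Finset.sum_apply]
    rfl

theorem minor_translate (w : GSp4 K) (i j : Fin 4) :
    IsUnipotentPoly fun g : GSp4 K => GSp4.minor (w * g) i j :=
  ((entry_translate w i 0).mul (entry_translate w j 1)).sub
    ((entry_translate w j 0).mul (entry_translate w i 1))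

/-- On the curve through `g` (at `s = 0`) and its unipotent translate (at `s = 1`), `f` and `q` are
nonzero polynomials, so they have a common nonvanishing point. -/
theorem exists_ne_zero [Infinite K] {f q : GSp4 K → K} (hf : IsUnipotentPoly f)
    (hq : IsUnipotentPoly q) {g : GSp4 K} (h : f g ≠ 0)
    (h1 : ∃ a b c d, q (low a b c d * g) ≠ 0 ∨ q (up a b c d * g) ≠ 0) :
    ∃ g, f g * q g ≠ 0 := by
  obtain ⟨a, b, c, d, h1 | h1⟩ := h1
  · obtain ⟨s, h2, h3⟩ := exists_ne_zero_of_polyFun (s₀ := 0) (s₁ := 1) (hf g a b c d).1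
      (hq g a b c d).1 (by simpa [low_zero] using h) (by simpa using h1)
    exact ⟨_, mul_ne_zero h2 h3⟩
  · obtain ⟨s, h2, h3⟩ := exists_ne_zero_of_polyFun (s₀ := 0) (s₁ := 1) (hf g a b c d).2
      (hq g a b c d).2 (by simpa [up_zero] using h) (by simpa using h1)
    exact ⟨_, mul_ne_zero h2 h3⟩

end IsUnipotentPoly

/-- The open set on which the semi-invariants of the Borel subgroup of `H` do not vanish is
dense. -/
theorem exists_generic [CharZero K] {f : GSp4 K → K} (hf : IsUnipotentPoly f) {g₀ : GSp4 K}
    (h : f g₀ ≠ 0) :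
    ∃ g, f g ≠ 0 ∧ mat g 3 0 ≠ 0 ∧ mat g 2 0 ≠ 0 ∧ minor g 2 3 ≠ 0 ∧ minor g 0 3 ≠ 0 := by
  have s1 : ∃ g, f g * mat g 3 0 ≠ 0 := by
    refine hf.exists_ne_zero (.entry 3 0) h ?_
    by_contra! hc
    obtain ⟨i, hi⟩ := exists_mat_ne_zero g₀
    have c0 := (hc 0 0 0 0).1
    have c1 := (hc 0 0 1 0).1
    have c2 := (hc 0 1 0 0).1
    have c3 := (hc 1 0 0 0).1
    simp [lowMat, Matrix.mul_apply, Fin.sum_univ_succ] at c0 c1 c2 c3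
    fin_cases i <;> simp_all
  obtain ⟨g₁, h1⟩ := s1
  have s2 : ∃ g, (f g * mat g 3 0) * mat g 2 0 ≠ 0 := by
    refine (hf.mul (.entry 3 0)).exists_ne_zero (.entry 2 0) h1 ?_
    by_contra! hc
    have c0 := (hc 0 0 0 0).2
    have c1 := (hc 1 0 0 0).2
    simp [lowMat, Matrix.mul_apply, Fin.sum_univ_succ] at c0 c1
    simp_all
  obtain ⟨g₂, h2⟩ := s2
  have s3 : ∃ g, (f g * mat g 3 0 * mat g 2 0) * minor g 2 3 ≠ 0 := by
    -- If the minor vanished at `g₂` and at the two translates used below, the minors `02` and `13`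
    -- would vanish as well. Three-term relations with the first column, `minor_form` and `mat g₂ 2
    -- 0 ≠ 0` would then kill all the others.
    refine ((hf.mul (.entry 3 0)).mul (.entry 2 0)).exists_ne_zero (.minor 2 3) h2 ?_
    by_contra! hc
    have c0 := (hc 0 0 0 0).1
    have c1 := (hc 0 0 1 0).1
    have c2 := (hc 0 0 0 1).1
    have hr := minor_form g₂
    simp [minor, lowMat, Matrix.mul_apply, Fin.sum_univ_succ] at c0 c1 c2
    have hx : mat g₂ 3 0 ≠ 0 := fun h => h2 (by simp [h])
    have hy : mat g₂ 2 0 ≠ 0 := fun h => h2 (by simp [h])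
    have q02 : minor g₂ 0 2 = 0 := by rw [minor]; linear_combination c0 - c1
    have q13 : minor g₂ 1 3 = 0 := by rw [minor]; linear_combination c2 - c0
    have q03 : minor g₂ 0 3 = 0 := mul_left_cancel₀ hy (by
      rw [minor] at *; linear_combination mat g₂ 0 0 * c0 + mat g₂ 3 0 * q02)
    have q12 : minor g₂ 1 2 = 0 := by linear_combination hr - q03
    have q01 : minor g₂ 0 1 = 0 := mul_left_cancel₀ hy (by
      rw [minor] at *; linear_combination mat g₂ 1 0 * q02 - mat g₂ 0 0 * q12)
    have q23 : minor g₂ 2 3 = 0 := c0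
    have hs : ∀ i j, minor g₂ i j = 0 → minor g₂ j i = 0 := fun i j h => by
      rw [minor] at *; linear_combination -h
    refine not_forall_minor_eq_zero g₂ fun i j => ?_
    by_cases hij : i = j
    · rw [hij, minor, sub_self]
    fin_cases i <;> fin_cases j <;> first
      | exact absurd rfl hij
      | assumption
      | exact hs _ _ (by assumption)
  obtain ⟨g₃, h3⟩ := s3
  have s4 : ∃ g, (f g * mat g 3 0 * mat g 2 0 * minor g 2 3) * minor g 0 3 ≠ 0 := by
    refine (((hf.mul (.entry 3 0)).mul (.entry 2 0)).mul (.minor 2 3)).exists_ne_zero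
      (.minor 0 3) h3 ?_
    by_contra! hc
    have c0 := (hc 0 0 0 0).2
    -- This translation adds row 2 to row 0, hence the minor `23` to the minor `03`.
    have c1 := (hc 0 1 0 0).2
    have h4 : minor g₃ 2 3 ≠ 0 := fun h => h3 (by simp [h])
    apply h4
    simp [minor, lowMat, Matrix.mul_apply, Fin.sum_univ_succ] at c0 c1 ⊢
    linear_combination c1 - c0
  obtain ⟨g₄, h4⟩ := s4
  simp only [ne_eq, mul_eq_zero, not_or] at h4
  exact ⟨g₄, h4.1.1.1.1, h4.1.1.1.2, h4.1.1.2, h4.1.2, h4.2⟩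

/-- The big cell is dense. -/
theorem eq_zero_of_bigCell [CharZero K] {f : GSp4 K → K}
    (hf : ∀ w, IsUnipotentPoly fun g => f (w * g))
    (h : ∀ g, mat g 0 0 ≠ 0 → minor g 0 1 ≠ 0 → f g = 0) (g : GSp4 K) : f g = 0 := by
  by_contra hg
  -- Left multiplication by `J` reverses the rows up to sign, so the big cell becomes the locus
  -- where the entry `30` and the minor `23` are nonzero.
  obtain ⟨w, hw⟩ : ∃ w : GSp4 K, mat w = symplJ K := ⟨ofMat (symplJ K) 1 (by
    ext i j
    fin_cases i <;> fin_cases j <;>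
      simp [symplJ, Matrix.mul_apply, Fin.sum_univ_succ]), rfl⟩
  obtain ⟨k, h1, h2, -, h3, -⟩ := exists_generic (hf w) (g₀ := w⁻¹ * g) (by simpa using hg)
  refine h1 (h _ ?_ ?_)
  · simpa [hw, symplJ, Matrix.mul_apply, Fin.sum_univ_succ] using h2
  · simp only [minor] at h3
    simp [minor, hw, symplJ, Matrix.mul_apply, Fin.sum_univ_succ]
    intro h4
    apply h3
    linear_combination -h4

end GSp4

namespace GL2xGL2

variable {K : Type*} [Field K]

/-- The element of `H` with given components. -/
noncomputable def ofMats (x y : Matrix (Fin 2) (Fin 2) K) (hx : x.det ≠ 0) (h : x.det = y.det) :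
    GL2xGL2 K :=
  ⟨(GeneralLinearGroup.mkOfDetNeZero x hx, GeneralLinearGroup.mkOfDetNeZero y (h ▸ hx)),
    Units.ext h⟩

@[simp] theorem ofMats_fst (x y : Matrix (Fin 2) (Fin 2) K) (hx : x.det ≠ 0) (h : x.det = y.det) :
    ((ofMats x y hx h).1.1 : Matrix (Fin 2) (Fin 2) K) = x := rfl

@[simp] theorem ofMats_snd (x y : Matrix (Fin 2) (Fin 2) K) (hx : x.det ≠ 0) (h : x.det = y.det) :
    ((ofMats x y hx h).1.2 : Matrix (Fin 2) (Fin 2) K) = y := rfl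

theorem blockTriangular_fin_two {a b d : K} :
    (!![a, b; 0, d] : Matrix (Fin 2) (Fin 2) K).BlockTriangular id := by
  intro i j hij
  fin_cases i <;> fin_cases j <;> simp_all

end GL2xGL2

@[simp] theorem mat_iota {K : Type*} [Field K] (h : GL2xGL2 K) :
    GSp4.mat (iota K h) = iotaMat h.1.1 h.1.2 := rfl

/-! ### Semi-invariant functionals and nonnegativity of the exponents. -/

namespace GSp4

variable {K : Type*} [Field K] {V : Type*} [AddCommGroup V] [Module K V]
  {ρ : Representation K (GSp4 K) V} {r₁ r₂ : ℕ} {v : V}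

/-- A functional that is semi-invariant under the Borel subgroup of `H` is determined on the orbit
of a highest weight vector by its value at one point. -/
theorem semiinvariant_eq (hv : ∀ b : GSp4 K, (b.1.1 : Matrix (Fin 4) (Fin 4) K).BlockTriangular id →
        ρ b v = ((b.1.1 : Matrix (Fin 4) (Fin 4) K) 0 0 ^ r₁
          * (b.1.1 : Matrix (Fin 4) (Fin 4) K) 1 1 ^ r₂) • v)
    {φ : V →ₗ[K] K} {t₁ t₂ : ℕ} {m : ℤ}
    (hφ : ∀ h : GL2xGL2 K, (h.1.1 : Matrix (Fin 2) (Fin 2) K).BlockTriangular id →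
      (h.1.2 : Matrix (Fin 2) (Fin 2) K).BlockTriangular id → ∀ x, φ (ρ (iota K h) x) =
        ((h.1.1 : Matrix (Fin 2) (Fin 2) K) 1 1 ^ t₁ * (h.1.2 : Matrix (Fin 2) (Fin 2) K) 1 1 ^ t₂
          * (h.1.1 : Matrix (Fin 2) (Fin 2) K).det ^ m) * φ x)
    (g : GSp4 K) (h3 : mat g 3 0 ≠ 0) (h2 : mat g 2 0 ≠ 0) (hp : minor g 2 3 ≠ 0)
    (hq : minor g 0 3 ≠ 0) :
    (mat g 2 0 * mat g 3 0 / minor g 2 3) ^ r₂ * φ (ρ g v) =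
      (mat g 3 0 ^ t₁ * mat g 2 0 ^ t₂ * (mat g 2 0 * mat g 3 0 * minor g 0 3 / minor g 2 3) ^ m)
        * φ (ρ (low 0 1 1 0) v) := by
  have hf := minor_form g
  have hd : (!![mat g 2 0 * minor g 0 3 / minor g 2 3, -(mat g 3 0 * minor g 0 2 / minor g 2 3);
      0, mat g 3 0] : Matrix (Fin 2) (Fin 2) K).det =
      mat g 2 0 * mat g 3 0 * minor g 0 3 / minor g 2 3 := by
    rw [det_fin_two_of]; ring
  -- The base point `low 0 1 1 0` has all four semi-invariants equal to `1`. This `h` in the Borel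
  -- subgroup of `H` carries its flag to the flag of `g`; it even reproduces the first column of `g`
  -- exactly.
  let h : GL2xGL2 K := GL2xGL2.ofMats
    !![mat g 2 0 * minor g 0 3 / minor g 2 3, -(mat g 3 0 * minor g 0 2 / minor g 2 3);
      0, mat g 3 0]
    !![mat g 3 0 * minor g 0 3 / minor g 2 3, mat g 1 0; 0, mat g 2 0]
    (by rw [hd]; positivity) (by rw [hd, det_fin_two_of]; ring)
  have e1 := hφ h GL2xGL2.blockTriangular_fin_two GL2xGL2.blockTriangular_fin_two
    (ρ (low 0 1 1 0) v)
  have e2 := apply_of_columns hv g (iota K h * low 0 1 1 0) 1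
    (-(mat g 3 0 * mat g 2 1 / minor g 2 3)) (mat g 2 0 * mat g 3 0 / minor g 2 3)
    (by
      intro i
      rw [one_mul, mat_mul, mat_iota]
      fin_cases i <;> simp [h, iotaMat, lowMat, Matrix.mul_apply, Fin.sum_univ_succ]
      field_simp
      simp only [minor]
      ring)
    (by
      intro i
      rw [mat_mul, mat_iota]
      fin_cases i <;> simp [h, iotaMat, lowMat, Matrix.mul_apply, Fin.sum_univ_succ]
      · field_simp
        simp only [minor]
        ring
      · field_simp
        simp only [minor] at hf ⊢
        linear_combination hf
      · field_simp
        ring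
      · field_simp
        simp only [minor]
        ring)
  rw [← Module.End.mul_apply, ← map_mul, e2, map_smul, smul_eq_mul, one_pow, one_mul] at e1
  rw [e1]
  simp only [h, GL2xGL2.ofMats_fst, GL2xGL2.ofMats_snd, hd]
  simp

/-- The weight of a functional that is semi-invariant under the Borel subgroup of `H`. -/
theorem weight_of_semiinvariant [CharZero K] (ha : IsAlgebraicRep coord ρ) (hi : ρ.IsIrreducible)
    (hv0 : v ≠ 0)
    (hv : ∀ b : GSp4 K, (b.1.1 : Matrix (Fin 4) (Fin 4) K).BlockTriangular id →
        ρ b v = ((b.1.1 : Matrix (Fin 4) (Fin 4) K) 0 0 ^ r₁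
          * (b.1.1 : Matrix (Fin 4) (Fin 4) K) 1 1 ^ r₂) • v)
    {φ : V →ₗ[K] K} (hφ0 : φ ≠ 0) {t₁ t₂ : ℕ} {m : ℤ}
    (hφ : ∀ h : GL2xGL2 K, (h.1.1 : Matrix (Fin 2) (Fin 2) K).BlockTriangular id →
      (h.1.2 : Matrix (Fin 2) (Fin 2) K).BlockTriangular id → ∀ x, φ (ρ (iota K h) x) =
        ((h.1.1 : Matrix (Fin 2) (Fin 2) K) 1 1 ^ t₁ * (h.1.2 : Matrix (Fin 2) (Fin 2) K) 1 1 ^ t₂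
          * (h.1.1 : Matrix (Fin 2) (Fin 2) K).det ^ m) * φ x) :
    0 ≤ m ∧ m ≤ r₂ ∧ r₂ ≤ t₁ + m ∧ r₂ ≤ t₂ + m := by
  obtain ⟨g, hg⟩ : ∃ g, φ (ρ g v) ≠ 0 := by
    by_contra! hc
    apply hφ0
    refine LinearMap.ext_on_range (hi.span_orbit_eq_top hv0) fun g => ?_
    simpa using hc g
  obtain ⟨g, hg, h3, h2, hp, hq⟩ :=
    exists_generic (IsUnipotentPoly.matrixCoeff ha φ v) hg
  have hc : φ (ρ (low 0 1 1 0) v) ≠ 0 := by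
    intro h0
    have := semiinvariant_eq hv hφ g h3 h2 hp hq
    rw [h0, mul_zero] at this
    have h4 : (mat g 2 0 * mat g 3 0 / minor g 2 3) ^ r₂ ≠ 0 := by positivity
    exact hg ((mul_eq_zero.1 this).resolve_left h4)
  have curve : ∀ a b c d : K → K, a ∈ polyFun K → b ∈ polyFun K → c ∈ polyFun K →
      d ∈ polyFun K → (fun s => φ (ρ (low (a s) (b s) (c s) (d s)) v)) ∈ polyFun K :=
    fun a b c d ha' hb hc hd => ha.coeff_mem _ _ (coord_low_mem _ ha' hb hc hd) φ v
  -- At `low a b c d` the semi-invariants `30`, `20`, `23`, `03` are `c`, `b`, `b(b - ad) - cd`, `b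
  -- - ad`. Each curve below makes one of them equal to `s` and the other three equal to `1`, so
  -- that the polynomial in `s` is a nonzero constant times a single power of `s`. The order of the
  -- curves is `03`, `23`, `30`, `20`.
  have key := fun a b c d => semiinvariant_eq hv hφ (low a b c d)
  simp [minor, lowMat] at key
  have hk := const_mem_subalgebra (polyFun K)
  have hs := id_mem_polyFun K
  refine ⟨?_, ?_, ?_, ?_⟩
  · refine exponent_nonneg_of_mem_polyFun
      (curve _ _ _ _ (hk (-1)) (hk 1) (hk 1) (sub_mem hs (hk 1))) hc fun s hs => ?_
    have := key (-1) 1 1 (s - 1)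
    simp [hs] at this
    rw [mul_comm, ← this]; rfl
  · have := exponent_nonneg_of_mem_polyFun (n := r₂ - m)
      (curve _ _ _ _ (hk 0) (hk 1) (hk 1) (sub_mem (hk 1) hs)) hc fun s hs => ?_
    · omega
    have := key 0 1 1 (1 - s)
    simp [hs] at this
    rw [zpow_sub₀ hs, zpow_natCast]
    field_simp
    change φ (ρ (low 0 1 1 (1 - s)) v) * _ = _
    field_simp at this
    linear_combination this
  · have := exponent_nonneg_of_mem_polyFun (n := t₁ + m - r₂)
      (curve _ _ _ _ (hk 0) (hk 1) hs (hk 0)) hc fun s hs => ?_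
    · omega
    have := key 0 1 s 0
    simp [hs] at this
    rw [zpow_sub₀ hs, zpow_add₀ hs, zpow_natCast, zpow_natCast]
    field_simp
    linear_combination this
  · have := exponent_nonneg_of_mem_polyFun (n := t₂ + m - r₂)
      (curve _ _ _ _ (hk 1) hs (hk 1) (sub_mem hs (hk 1))) hc fun s hs => ?_
    · omega
    have := key 1 s 1 (s - 1)
    simp [hs] at this
    rw [zpow_sub₀ hs, zpow_add₀ hs, zpow_natCast, zpow_natCast]
    field_simp
    change φ (ρ (low 1 s 1 (s - 1)) v) * _ = _
    linear_combination this

end GSp4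

/-! ### The lowest weight functional on a representation of `GSp₄`. -/

namespace GSp4

variable {K : Type*} [Field K] {V : Type*} [AddCommGroup V] [Module K V]
  {ρ : Representation K (GSp4 K) V} {r₁ r₂ : ℕ} {v : V}

/-- An element of the big cell has the same first columns, up to the action of the Borel subgroup,
as a lower unipotent element. -/
theorem apply_of_bigCell
    (hv : ∀ b : GSp4 K, (b.1.1 : Matrix (Fin 4) (Fin 4) K).BlockTriangular id →
        ρ b v = ((b.1.1 : Matrix (Fin 4) (Fin 4) K) 0 0 ^ r₁
          * (b.1.1 : Matrix (Fin 4) (Fin 4) K) 1 1 ^ r₂) • v)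
    (g : GSp4 K) (h0 : mat g 0 0 ≠ 0) (h1 : minor g 0 1 ≠ 0) :
    ∃ a b c d : K, (∀ i, mat g i 0 = mat g 0 0 * lowMat a b c d i 0) ∧
      (∀ i j, minor g i j = minor g 0 1 * minor (low a b c d) i j) ∧
      ρ g v = (mat g 0 0 ^ r₁ * (minor g 0 1 / mat g 0 0) ^ r₂) • ρ (low a b c d) v := by
  have hf := minor_form g
  let a := mat g 1 0 / mat g 0 0
  let b := mat g 2 0 / mat g 0 0
  let c := mat g 3 0 / mat g 0 0
  let d := minor g 0 2 / minor g 0 1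
  have e0 : ∀ i, mat g i 0 = mat g 0 0 * lowMat a b c d i 0 := by
    intro i
    fin_cases i <;> simp [lowMat, a, b, c] <;> field_simp
  have e1 : ∀ i, mat g i 1 = mat g 0 1 * lowMat a b c d i 0
      + minor g 0 1 / mat g 0 0 * lowMat a b c d i 1 := by
    intro i
    fin_cases i <;> simp [lowMat, a, b, c, d] <;> field_simp <;> simp only [minor] at hf ⊢
    · ring
    · ring
    · linear_combination mat g 0 0 * hf
  refine ⟨a, b, c, d, e0, fun i j => ?_, ?_⟩
  · rw [minor, e0 i, e0 j, e1 i, e1 j, minor.eq_1 (low a b c d), mat_low]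
    field_simp
    ring
  · refine apply_of_columns hv (low a b c d) g _ (mat g 0 1) _ e0 fun i => ?_
    rw [e1 i]; rfl

/-- The lowest weight functional on a highest weight representation. -/
theorem exists_lowest_functional [CharZero K] (ha : IsAlgebraicRep coord ρ) (hr : r₂ ≤ r₁)
    (hv0 : v ≠ 0)
    (hv : ∀ b : GSp4 K, (b.1.1 : Matrix (Fin 4) (Fin 4) K).BlockTriangular id →
        ρ b v = ((b.1.1 : Matrix (Fin 4) (Fin 4) K) 0 0 ^ r₁
          * (b.1.1 : Matrix (Fin 4) (Fin 4) K) 1 1 ^ r₂) • v) :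
    ∃ φ : V →ₗ[K] K, ∀ g, φ (ρ g v) = mat g 0 0 ^ (r₁ - r₂) * minor g 0 1 ^ r₂ := by
  obtain ⟨ψ, hψ⟩ : ∃ ψ : V →ₗ[K] K, ψ v = 1 := by
    exact Module.Projective.exists_dual_eq_one K hv0
  -- Project `ψ` to the torus weight of `v`, which is `z ^ r₂`. Conjugation by `torus z` contracts
  -- the lower unipotent elements to `1` as `z → 0`, so the projected functional takes the value `ψ
  -- v = 1` on all of their translates of `v`.
  obtain ⟨φ, hφ⟩ := exists_laurent_coeff (fun z => ψ ∘ₗ ρ (torus z))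
    (fun w => ha.coeff_mem _ _ coord_torus_mem ψ w) r₂
  have hlow : ∀ a b c d, φ (ρ (low a b c d) v) = 1 := by
    intro a b c d
    have hs := id_mem_polyFun K
    have hk := const_mem_subalgebra (polyFun K)
    obtain ⟨p, hp⟩ := mem_polyFun.1 (ha.coeff_mem _ _ (coord_low_mem _ (mul_mem hs (hk a))
      (mul_mem (pow_mem hs 2) (hk b)) (mul_mem (pow_mem hs 3) (hk c)) (mul_mem hs (hk d))) ψ v)
    rw [hφ _ 0 (p * Polynomial.X ^ r₂) fun z => ?_, add_zero, Polynomial.coeff_mul_X_pow',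
      if_pos le_rfl, Nat.sub_self, Polynomial.coeff_zero_eq_eval_zero, ← hp]
    · simpa [low_zero] using hψ
    · have ht := hv (torus z) (by
        intro i j hij
        change mat (torus z) i j = 0
        fin_cases i <;> fin_cases j <;> simp_all [torus])
      rw [LinearMap.comp_apply, ← Module.End.mul_apply, ← map_mul, torus_mul_low, map_mul,
        Module.End.mul_apply, ht, map_smul, map_smul]
      simp only [Polynomial.eval_mul, ← hp]
      change _ * ((mat (torus z) 0 0 ^ r₁ * mat (torus z) 1 1 ^ r₂) • _) = _
      simp [torus]
      ring
  refine ⟨φ, fun g => sub_eq_zero.1 ?_⟩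
  refine eq_zero_of_bigCell (f := fun g => φ (ρ g v) - mat g 0 0 ^ (r₁ - r₂) * minor g 0 1 ^ r₂)
    (fun w => ?_) (fun g h0 h1 => ?_) g
  · refine .sub ?_ (((IsUnipotentPoly.entry_translate w 0 0).pow _).mul
      ((IsUnipotentPoly.minor_translate w 0 1).pow _))
    simpa using IsUnipotentPoly.matrixCoeff ha (φ ∘ₗ ρ w) v
  · obtain ⟨a, b, c, d, -, -, h⟩ := apply_of_bigCell hv g h0 h1
    rw [h, map_smul, hlow, sub_eq_zero, div_pow, smul_eq_mul]
    obtain ⟨k, rfl⟩ := Nat.exists_eq_add_of_le hr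
    rw [Nat.add_sub_cancel_left, pow_add]
    field_simp

end GSp4

/-! ### Monomials in the semi-invariants as matrix coefficients. -/

namespace GSp4

variable {K : Type*} [Field K]

/-- The products of the basic semi-invariants of the Borel subgroup of `H`. -/
def semiInv (nA nB nC nD : ℕ) (g : GSp4 K) : K :=
  mat g 3 0 ^ nA * mat g 2 0 ^ nB * minor g 2 3 ^ nC * minor g 0 3 ^ nD

theorem lowMat_cast [CharZero K] (a b c d : ℚ) (i j : Fin 4) :
    lowMat (a : K) b c d i j = ((lowMat a b c d i j : ℚ) : K) := by
  fin_cases i <;> fin_cases j <;> simp [lowMat]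

theorem sum_entry_mul_entry (y z : Fin 4 → K) :
    ∑ i, mat (low (y 0) (y 1) (y 2) (y 3)) i 0 * mat (low (z 0) (z 1) (z 2) (z 3)) i 0 =
      mat (up (y 0) (y 1) (y 2) (y 3) * low (z 0) (z 1) (z 2) (z 3)) 0 0 := by
  rw [mat_mul, Matrix.mul_apply]; rfl

/-- Cauchy–Binet, since `up y` is the transpose of `low y`. The factor `2` appears because the sum
runs over ordered pairs of rows. -/
theorem sum_minor_mul_minor (y z : Fin 4 → K) :
    ∑ p : Fin 4 × Fin 4, minor (low (y 0) (y 1) (y 2) (y 3)) p.1 p.2 *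
        minor (low (z 0) (z 1) (z 2) (z 3)) p.1 p.2 =
      2 * minor (up (y 0) (y 1) (y 2) (y 3) * low (z 0) (z 1) (z 2) (z 3)) 0 1 := by
  rw [Fintype.sum_prod_type]
  simp only [minor, mat_mul, mat_up, Matrix.mul_apply, transpose_apply, Fin.sum_univ_four, mat_low]
  ring

/-- A product of semi-invariants is, on lower unipotent elements, a combination of translates of
the lowest weight function. -/
theorem exists_semiInv_combination (nA nB nC nD : ℕ) :
    ∃ c : (Fin 4 → ℚ) →₀ ℚ, ∀ z : Fin 4 → ℚ,
      semiInv nA nB nC nD (low (z 0) (z 1) (z 2) (z 3)) = c.sum fun y a => a *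
        (mat (up (y 0) (y 1) (y 2) (y 3) * low (z 0) (z 1) (z 2) (z 3)) 0 0 ^ (nA + nB) *
          (2 * minor (up (y 0) (y 1) (y 2) (y 3) * low (z 0) (z 1) (z 2) (z 3)) 0 1)
            ^ (nC + nD)) := by
  let u : (Fin 4 → ℚ) → ((Fin (nA + nB) → Fin 4) × (Fin (nC + nD) → Fin 4 × Fin 4)) → ℚ :=
    fun z p => (∏ k, mat (low (z 0) (z 1) (z 2) (z 3)) (p.1 k) 0) *
      ∏ k, minor (low (z 0) (z 1) (z 2) (z 3)) (p.2 k).1 (p.2 k).2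
  -- The vectors `u z` are tensor powers of the first column and of the vector of minors. Their dot
  -- products are the translated lowest weight functions, and the chosen coordinate of `u z` is the
  -- monomial.
  obtain ⟨c, hc⟩ := exists_dotProduct_combination u (Pi.single
    (Fin.append (fun _ => 3) (fun _ => 2), Fin.append (fun _ => (2, 3)) (fun _ => (0, 3))) 1)
  refine ⟨c, fun z => ?_⟩
  have h1 := hc z
  rw [single_dotProduct, one_mul] at h1
  have h2 : semiInv nA nB nC nD (low (z 0) (z 1) (z 2) (z 3)) = u z
    (Fin.append (fun _ => 3) (fun _ => 2), Fin.append (fun _ => (2, 3)) (fun _ => (0, 3))) := by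
    simp only [u, Fin.prod_univ_add, Fin.append_left, Fin.append_right, Finset.prod_const,
      Finset.card_univ, Fintype.card_fin, semiInv]
    ring
  rw [h2, h1]
  congr 1
  funext y a
  congr 1
  rw [← sum_entry_mul_entry, ← sum_minor_mul_minor, Fintype.sum_pow, Fintype.sum_pow,
    Finset.sum_mul_sum, dotProduct, Fintype.sum_prod_type]
  refine Finset.sum_congr rfl fun p _ => Finset.sum_congr rfl fun q _ => ?_
  simp only [u, Finset.prod_mul_distrib]
  ring

/-- The projection argument needs an ordered field. Rational points are Zariski dense in affine
space over `K`, so the identity over `ℚ` passes to `K`. -/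
theorem eq_of_eq_on_rat [CharZero K] {f q : (Fin 4 → K) → K} (hf : f ∈ mvPolyFun K (Fin 4))
    (hq : q ∈ mvPolyFun K (Fin 4)) (h : ∀ z : Fin 4 → ℚ, f (fun i => z i) = q (fun i => z i)) :
    f = q := by
  obtain ⟨P, hP⟩ := mem_mvPolyFun.1 hf
  obtain ⟨Q, hQ⟩ := mem_mvPolyFun.1 hq
  have : P = Q := MvPolynomial.funext_set (fun _ => Set.range ((↑) : ℚ → K))
    (fun _ => Set.infinite_range_of_injective Rat.cast_injective) (fun x hx => by
      choose z hz using fun i => hx i trivial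
      obtain rfl : (fun i => (z i : K)) = x := funext hz
      rw [← hP, ← hQ, h])
  funext z
  rw [hP, hQ, this]

variable {V : Type*} [AddCommGroup V] [Module K V]
  {ρ : Representation K (GSp4 K) V} {r₁ r₂ : ℕ} {v : V}

theorem exists_semiInv_functional [CharZero K] (ha : IsAlgebraicRep coord ρ)
    (hv0 : v ≠ 0)
    (hv : ∀ b : GSp4 K, (b.1.1 : Matrix (Fin 4) (Fin 4) K).BlockTriangular id →
        ρ b v = ((b.1.1 : Matrix (Fin 4) (Fin 4) K) 0 0 ^ r₁
          * (b.1.1 : Matrix (Fin 4) (Fin 4) K) 1 1 ^ r₂) • v)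
    {nA nB nC nD : ℕ} (h₁ : r₁ = nA + nB + r₂) (h₂ : r₂ = nC + nD) :
    ∃ φ : V →ₗ[K] K, ∀ g, φ (ρ g v) = semiInv nA nB nC nD g := by
  obtain ⟨φ₀, hφ₀⟩ := exists_lowest_functional ha (by omega) hv0 hv
  obtain ⟨c, hc⟩ := exists_semiInv_combination nA nB nC nD
  -- The factor `2 ^ r₂` absorbs the `2` from the ordered pairs of rows.
  let φ : V →ₗ[K] K := c.sum fun y a =>
    ((a * 2 ^ r₂ : ℚ) : K) • (φ₀ ∘ₗ ρ (up (y 0 : K) (y 1) (y 2) (y 3)))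
  have hrat : ∀ z : Fin 4 → ℚ, φ (ρ (low (z 0 : K) (z 1) (z 2) (z 3)) v) =
      semiInv nA nB nC nD (low (z 0 : K) (z 1) (z 2) (z 3)) := by
    intro z
    have h3 : semiInv nA nB nC nD (low (z 0 : K) (z 1) (z 2) (z 3)) =
        ((semiInv nA nB nC nD (low (z 0) (z 1) (z 2) (z 3)) : ℚ) : K) := by
      simp [semiInv, minor, lowMat_cast]
    rw [h3, hc z]
    simp only [φ, Finsupp.sum, LinearMap.sum_apply, Rat.cast_sum]
    refine Finset.sum_congr rfl fun y _ => ?_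
    rw [LinearMap.smul_apply, LinearMap.comp_apply, ← Module.End.mul_apply, ← map_mul, hφ₀,
      show r₁ - r₂ = nA + nB by omega, mul_pow, ← h₂]
    simp [minor, lowMat_cast, Matrix.mul_apply]
    ring
  have hlow : ∀ a b c d, φ (ρ (low a b c d) v) = semiInv nA nB nC nD (low a b c d) := by
    have hx := fun i => coord_mem_mvPolyFun (K := K) (ι := Fin 4) i
    have hl := fun i j => coord_low_mem _ (hx 0) (hx 1) (hx 2) (hx 3) (.inl (i, j))
    have hm : ∀ i j, (fun z : Fin 4 → K => minor (low (z 0) (z 1) (z 2) (z 3)) i j) ∈ _ :=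
      fun i j => sub_mem (mul_mem (hl i 0) (hl j 1)) (mul_mem (hl j 0) (hl i 1))
    have := eq_of_eq_on_rat
      (ha.coeff_mem _ _ (coord_low_mem _ (hx 0) (hx 1) (hx 2) (hx 3)) φ v)
      (mul_mem (mul_mem (mul_mem (pow_mem (hl 3 0) nA) (pow_mem (hl 2 0) nB))
        (pow_mem (hm 2 3) nC)) (pow_mem (hm 0 3) nD)) hrat
    intro a b c d
    exact congrFun this ![a, b, c, d]
  refine ⟨φ, fun g => sub_eq_zero.1 ?_⟩
  refine eq_zero_of_bigCell (f := fun g => φ (ρ g v) - semiInv nA nB nC nD g)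
    (fun w => ?_) (fun g h0 h1 => ?_) g
  · refine .sub ?_ (((((IsUnipotentPoly.entry_translate w 3 0).pow _).mul
      ((IsUnipotentPoly.entry_translate w 2 0).pow _)).mul
      ((IsUnipotentPoly.minor_translate w 2 3).pow _)).mul
      ((IsUnipotentPoly.minor_translate w 0 3).pow _))
    simpa using IsUnipotentPoly.matrixCoeff ha (φ ∘ₗ ρ w) v
  · obtain ⟨a, b, c, d, h3, h4, h⟩ := apply_of_bigCell hv g h0 h1
    rw [h, map_smul, hlow, sub_eq_zero, semiInv, semiInv, h3 3, h3 2, h4 2 3, h4 0 3, div_pow,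
      h₁, pow_add, h₂, smul_eq_mul, mat_low]
    field_simp
    ring

end GSp4

/-! ### Representations of `H` and bihomogeneous polynomials in the first columns. -/

namespace GL2xGL2

variable {K : Type*} [Field K]

/-- The matrix of the first component. -/
def fst (h : GL2xGL2 K) : Matrix (Fin 2) (Fin 2) K := h.1.1

/-- The matrix of the second component. -/
def snd (h : GL2xGL2 K) : Matrix (Fin 2) (Fin 2) K := h.1.2

@[simp] theorem fst_mul (g h : GL2xGL2 K) : fst (g * h) = fst g * fst h := rfl

@[simp] theorem snd_mul (g h : GL2xGL2 K) : snd (g * h) = snd g * snd h := rfl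

@[simp] theorem fst_one : fst (1 : GL2xGL2 K) = 1 := rfl

@[simp] theorem snd_one : snd (1 : GL2xGL2 K) = 1 := rfl

@[simp] theorem fst_ofMats (x y : Matrix (Fin 2) (Fin 2) K) (hx : x.det ≠ 0) (h : x.det = y.det) :
    fst (ofMats x y hx h) = x := rfl

@[simp] theorem snd_ofMats (x y : Matrix (Fin 2) (Fin 2) K) (hx : x.det ≠ 0) (h : x.det = y.det) :
    snd (ofMats x y hx h) = y := rfl

theorem ext_mat {g h : GL2xGL2 K} (h1 : fst g = fst h) (h2 : snd g = snd h) : g = h :=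
  Subtype.ext (Prod.ext (Units.ext h1) (Units.ext h2))

theorem det_fst_ne_zero (h : GL2xGL2 K) : (fst h).det ≠ 0 :=
  (GeneralLinearGroup.det h.1.1).ne_zero

theorem det_snd (h : GL2xGL2 K) : (snd h).det = (fst h).det :=
  (congrArg Units.val h.2).symm

theorem fst_inv (h : GL2xGL2 K) :
    fst h⁻¹ = (fst h).det⁻¹ • !![fst h 1 1, -fst h 0 1; -fst h 1 0, fst h 0 0] := by
  have : fst h⁻¹ = (fst h)⁻¹ := Matrix.coe_units_inv h.1.1
  rw [this, Matrix.inv_def, Matrix.adjugate_fin_two, Ring.inverse_eq_inv']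

theorem snd_inv (h : GL2xGL2 K) :
    snd h⁻¹ = (fst h).det⁻¹ • !![snd h 1 1, -snd h 0 1; -snd h 1 0, snd h 0 0] := by
  have : snd h⁻¹ = (snd h)⁻¹ := Matrix.coe_units_inv h.1.2
  rw [this, Matrix.inv_def, Matrix.adjugate_fin_two, Ring.inverse_eq_inv', det_snd]

/-- The lower unipotent elements of `H`. -/
noncomputable def low (c c' : K) : GL2xGL2 K :=
  ofMats !![1, 0; c, 1] !![1, 0; c', 1] (by simp [det_fin_two]) (by simp [det_fin_two])

/-- The upper unipotent elements of `H`. -/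
noncomputable def up (c c' : K) : GL2xGL2 K :=
  ofMats !![1, c; 0, 1] !![1, c'; 0, 1] (by simp [det_fin_two]) (by simp [det_fin_two])

/-- The element `diag(1, z)`, embedded diagonally in `H`. -/
noncomputable def torus (z : Kˣ) : GL2xGL2 K :=
  ofMats !![1, 0; 0, (z : K)] !![1, 0; 0, (z : K)] (by simp [det_fin_two]) rfl

theorem torus_mul_low (z : Kˣ) (c c' : K) :
    torus z * low c c' = low (z * c) (z * c') * torus z := by
  refine ext_mat ?_ ?_ <;>
  · ext i j
    fin_cases i <;> fin_cases j <;> simp [torus, low]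

theorem low_zero : low (0 : K) 0 = 1 := by
  refine ext_mat ?_ ?_ <;>
  · ext i j
    fin_cases i <;> fin_cases j <;> simp [low]

theorem up_zero : up (0 : K) 0 = 1 := by
  refine ext_mat ?_ ?_ <;>
  · ext i j
    fin_cases i <;> fin_cases j <;> simp [up]

theorem coord_low_mem {Z : Type*} (F : Subalgebra K (Z → K)) {a b : Z → K} (ha : a ∈ F)
    (hb : b ∈ F) (i : ((Fin 2 × Fin 2) ⊕ (Fin 2 × Fin 2)) ⊕ Unit) :
    (fun z => coord (low (a z) (b z)) i) ∈ F := by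
  have h0 := const_mem_subalgebra F 0
  have h1 := const_mem_subalgebra F 1
  rcases i with (⟨i, j⟩ | ⟨i, j⟩) | i
  · fin_cases i <;> fin_cases j <;> assumption
  · fin_cases i <;> fin_cases j <;> assumption
  · convert h1 using 2 with z
    simp [coord, low, ofMats, GeneralLinearGroup.mkOfDetNeZero, det_fin_two]

theorem coord_up_mem {Z : Type*} (F : Subalgebra K (Z → K)) {a b : Z → K} (ha : a ∈ F)
    (hb : b ∈ F) (i : ((Fin 2 × Fin 2) ⊕ (Fin 2 × Fin 2)) ⊕ Unit) :
    (fun z => coord (up (a z) (b z)) i) ∈ F := by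
  have h0 := const_mem_subalgebra F 0
  have h1 := const_mem_subalgebra F 1
  rcases i with (⟨i, j⟩ | ⟨i, j⟩) | i
  · fin_cases i <;> fin_cases j <;> assumption
  · fin_cases i <;> fin_cases j <;> assumption
  · convert h1 using 2 with z
    simp [coord, up, ofMats, GeneralLinearGroup.mkOfDetNeZero, det_fin_two]

theorem coord_torus_mem (i : ((Fin 2 × Fin 2) ⊕ (Fin 2 × Fin 2)) ⊕ Unit) :
    (fun z : Kˣ => coord (torus z) i) ∈ laurentFun K := by
  have h0 := const_mem_subalgebra (laurentFun K) 0
  have h1 := const_mem_subalgebra (laurentFun K) 1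
  have hz := val_mem_laurentFun K
  rcases i with (⟨i, j⟩ | ⟨i, j⟩) | i
  · fin_cases i <;> fin_cases j <;> assumption
  · fin_cases i <;> fin_cases j <;> assumption
  · convert inv_mem_laurentFun K using 2 with z
    simp [coord, torus, ofMats, GeneralLinearGroup.mkOfDetNeZero, det_fin_two]

theorem fst_col_ne_zero (h : GL2xGL2 K) : fst h 0 0 ≠ 0 ∨ fst h 1 0 ≠ 0 := by
  by_contra! hc
  exact det_fst_ne_zero h (by rw [det_fin_two, hc.1, hc.2]; ring)

theorem snd_col_ne_zero (h : GL2xGL2 K) : snd h 0 0 ≠ 0 ∨ snd h 1 0 ≠ 0 := by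
  by_contra! hc
  exact det_fst_ne_zero h (by rw [← det_snd, det_fin_two, hc.1, hc.2]; ring)

variable {W : Type*} [AddCommGroup W] [Module K W] {σ : Representation K (GL2xGL2 K) W}
  {t₁ t₂ : ℕ} {w : W}

theorem apply_of_bigCell
    (hw : ∀ b : GL2xGL2 K, (b.1.1 : Matrix (Fin 2) (Fin 2) K).BlockTriangular id →
      (b.1.2 : Matrix (Fin 2) (Fin 2) K).BlockTriangular id →
        σ b w = ((b.1.1 : Matrix (Fin 2) (Fin 2) K) 0 0 ^ t₁
          * (b.1.2 : Matrix (Fin 2) (Fin 2) K) 0 0 ^ t₂) • w)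
    (h : GL2xGL2 K) (h1 : fst h 0 0 ≠ 0) (h2 : snd h 0 0 ≠ 0) :
    σ h w = (fst h 0 0 ^ t₁ * snd h 0 0 ^ t₂) •
      σ (low (fst h 1 0 / fst h 0 0) (snd h 1 0 / snd h 0 0)) w := by
  have hd := det_snd h
  let b : GL2xGL2 K := ofMats !![fst h 0 0, fst h 0 1; 0, (fst h).det / fst h 0 0]
    !![snd h 0 0, snd h 0 1; 0, (snd h).det / snd h 0 0]
    (by rw [det_fin_two_of]; field_simp; simpa using det_fst_ne_zero h)
    (by rw [det_fin_two_of, det_fin_two_of, hd]; field_simp; ring)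
  have hb : h = low (fst h 1 0 / fst h 0 0) (snd h 1 0 / snd h 0 0) * b := by
    refine ext_mat ?_ ?_
    · ext i j
      fin_cases i <;> fin_cases j <;> simp [low, b, h1]
      rw [det_fin_two]
      field_simp
      ring
    · ext i j
      fin_cases i <;> fin_cases j <;> simp [low, b, h2]
      rw [det_fin_two]
      field_simp
      ring
  conv_lhs => rw [hb]
  rw [map_mul, Module.End.mul_apply, hw b blockTriangular_fin_two blockTriangular_fin_two, map_smul]
  rfl

/-- The lowest weight functional on a highest weight representation of `H`. -/
theorem exists_lowest_functional [CharZero K] (ha : IsAlgebraicRep coord σ) (hw0 : w ≠ 0)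
    (hw : ∀ b : GL2xGL2 K, (b.1.1 : Matrix (Fin 2) (Fin 2) K).BlockTriangular id →
      (b.1.2 : Matrix (Fin 2) (Fin 2) K).BlockTriangular id →
        σ b w = ((b.1.1 : Matrix (Fin 2) (Fin 2) K) 0 0 ^ t₁
          * (b.1.2 : Matrix (Fin 2) (Fin 2) K) 0 0 ^ t₂) • w) :
    ∃ ψ : W →ₗ[K] K, ∀ h, ψ (σ h w) = fst h 0 0 ^ t₁ * snd h 0 0 ^ t₂ := by
  obtain ⟨ψ₀, hψ₀⟩ := Module.Projective.exists_dual_eq_one K hw0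
  obtain ⟨ψ, hψ⟩ := exists_laurent_coeff (fun z => ψ₀ ∘ₗ σ (torus z))
    (fun x => ha.coeff_mem _ _ coord_torus_mem ψ₀ x) 0
  have hs := id_mem_polyFun K
  have hk := const_mem_subalgebra (polyFun K)
  -- The torus contracts lower unipotent elements to `1` and fixes `w`, so the coefficient of `z ^
  -- 0` is `ψ₀ w = 1`.
  have hlow : ∀ c c', ψ (σ (low c c') w) = 1 := by
    intro c c'
    obtain ⟨p, hp⟩ := mem_polyFun.1 (ha.coeff_mem _ _ (coord_low_mem _ (mul_mem hs (hk c))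
      (mul_mem hs (hk c'))) ψ₀ w)
    rw [hψ _ 0 p fun z => ?_, add_zero, Polynomial.coeff_zero_eq_eval_zero, ← hp]
    · simpa [low_zero] using hψ₀
    · have ht := hw (torus z) blockTriangular_fin_two blockTriangular_fin_two
      rw [LinearMap.comp_apply, ← Module.End.mul_apply, ← map_mul, torus_mul_low, map_mul,
        Module.End.mul_apply, ht, map_smul, map_smul, ← hp]
      simp [torus]
  have hbig : ∀ h, fst h 0 0 ≠ 0 → snd h 0 0 ≠ 0 →
      ψ (σ h w) = fst h 0 0 ^ t₁ * snd h 0 0 ^ t₂ := fun h h1 h2 => by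
    rw [apply_of_bigCell hw h h1 h2, map_smul, hlow, smul_eq_mul, mul_one]
  refine ⟨ψ, fun h => ?_⟩
  -- The curve `up s s * h` meets the big cell, so the polynomial identity in `s` extends to `s =
  -- 0`.
  have m1 : (fun s => fst h 0 0 + s * fst h 1 0) ∈ polyFun K :=
    add_mem (hk _) (mul_mem hs (hk _))
  have m2 : (fun s => snd h 0 0 + s * snd h 1 0) ∈ polyFun K :=
    add_mem (hk _) (mul_mem hs (hk _))
  have e1 : ∀ s, fst (up s s * h) 0 0 = fst h 0 0 + s * fst h 1 0 := fun s => by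
    simp [up, Matrix.mul_apply]
  have e2 : ∀ s, snd (up s s * h) 0 0 = snd h 0 0 + s * snd h 1 0 := fun s => by
    simp [up, Matrix.mul_apply]
  obtain ⟨s₁, hs₁⟩ : ∃ s, fst h 0 0 + s * fst h 1 0 ≠ 0 := by
    by_contra! hc
    have h0 := hc 0
    have h1 := hc 1
    have := fst_col_ne_zero h
    simp_all
  obtain ⟨s₂, hs₂⟩ : ∃ s, snd h 0 0 + s * snd h 1 0 ≠ 0 := by
    by_contra! hc
    have h0 := hc 0
    have h1 := hc 1
    have := snd_col_ne_zero h
    simp_all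
  obtain ⟨s₀, hs₀⟩ := exists_ne_zero_of_polyFun m1 m2 hs₁ hs₂
  have m3 := ha.coeff_mem _ _ (coord_up_mem _ hs hs) ψ (σ h w)
  have := polyFun_eq_zero_of_mul (sub_mem m3 (mul_mem (pow_mem m1 t₁) (pow_mem m2 t₂)))
    (mul_mem m1 m2) (s₀ := s₀) (fun s => ?_) (mul_ne_zero hs₀.1 hs₀.2) 0
  · simpa [up_zero, sub_eq_zero] using this
  · by_cases h1 : fst h 0 0 + s * fst h 1 0 = 0
    · simp [h1]
    by_cases h2 : snd h 0 0 + s * snd h 1 0 = 0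
    · simp [h2]
    have := hbig (up s s * h) (by rwa [e1]) (by rwa [e2])
    rw [e1, e2, map_mul, Module.End.mul_apply] at this
    simp [this]

theorem coeff_linear_pow (a c : K) (n j : ℕ) :
    ((Polynomial.C c * Polynomial.X + Polynomial.C a) ^ n).coeff j =
      n.choose j * (a ^ (n - j) * c ^ j) := by
  have : (Polynomial.C c * Polynomial.X + Polynomial.C a) ^ n =
      ((Polynomial.X + Polynomial.C a) ^ n).comp (Polynomial.C c * Polynomial.X) := by simp
  rw [this, Polynomial.comp_C_mul_X_coeff, Polynomial.coeff_X_add_C_pow]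
  ring

/-- Every monomial in the first columns is a matrix coefficient of a highest weight vector. -/
theorem exists_monomial_functional [CharZero K] (ha : IsAlgebraicRep coord σ) (hw0 : w ≠ 0)
    (hw : ∀ b : GL2xGL2 K, (b.1.1 : Matrix (Fin 2) (Fin 2) K).BlockTriangular id →
      (b.1.2 : Matrix (Fin 2) (Fin 2) K).BlockTriangular id →
        σ b w = ((b.1.1 : Matrix (Fin 2) (Fin 2) K) 0 0 ^ t₁
          * (b.1.2 : Matrix (Fin 2) (Fin 2) K) 0 0 ^ t₂) • w)
    {j k : ℕ} (hj : j ≤ t₁) (hk : k ≤ t₂) :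
    ∃ ψ : W →ₗ[K] K, ∀ h, ψ (σ h w) =
      fst h 0 0 ^ (t₁ - j) * fst h 1 0 ^ j * (snd h 0 0 ^ (t₂ - k) * snd h 1 0 ^ k) := by
  obtain ⟨ψ₀, hψ₀⟩ := exists_lowest_functional ha hw0 hw
  have hs := val_mem_laurentFun K
  have h0 := const_mem_subalgebra (laurentFun K) 0
  -- Translation by `up z 0` turns `h₀₀ ^ t₁` into `(h₀₀ + z h₁₀) ^ t₁`; the coefficient of `z ^ j`
  -- is the wanted monomial times a binomial coefficient, which is invertible in characteristic `0`.
  obtain ⟨ψ₁, hψ₁⟩ := exists_laurent_coeff (fun z => ψ₀ ∘ₗ σ (up z 0))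
    (fun x => ha.coeff_mem _ _ (coord_up_mem _ hs h0) ψ₀ x) j
  have h1 : ∀ h, ψ₁ (σ h w) =
      t₁.choose j * (fst h 0 0 ^ (t₁ - j) * fst h 1 0 ^ j) * snd h 0 0 ^ t₂ := by
    intro h
    rw [hψ₁ _ 0 ((Polynomial.C (fst h 1 0) * Polynomial.X + Polynomial.C (fst h 0 0)) ^ t₁ *
      Polynomial.C (snd h 0 0 ^ t₂)) fun z => ?_, Polynomial.coeff_mul_C, add_zero,
      coeff_linear_pow]
    rw [LinearMap.comp_apply, ← Module.End.mul_apply, ← map_mul, hψ₀]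
    simp [up, Matrix.mul_apply]
    left
    ring
  obtain ⟨ψ₂, hψ₂⟩ := exists_laurent_coeff (fun z => ψ₁ ∘ₗ σ (up 0 z))
    (fun x => ha.coeff_mem _ _ (coord_up_mem _ h0 hs) ψ₁ x) k
  have h2 : ∀ h, ψ₂ (σ h w) = t₁.choose j * (fst h 0 0 ^ (t₁ - j) * fst h 1 0 ^ j) *
      (t₂.choose k * (snd h 0 0 ^ (t₂ - k) * snd h 1 0 ^ k)) := by
    intro h
    rw [hψ₂ _ 0 (Polynomial.C (t₁.choose j * (fst h 0 0 ^ (t₁ - j) * fst h 1 0 ^ j)) *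
      (Polynomial.C (snd h 1 0) * Polynomial.X + Polynomial.C (snd h 0 0)) ^ t₂) fun z => ?_,
      Polynomial.coeff_C_mul, add_zero, coeff_linear_pow]
    rw [LinearMap.comp_apply, ← Module.End.mul_apply, ← map_mul, h1]
    simp [up, Matrix.mul_apply]
    left
    ring
  have c1 : (t₁.choose j : K) ≠ 0 := Nat.cast_ne_zero.2 (Nat.choose_pos hj).ne'
  have c2 : (t₂.choose k : K) ≠ 0 := Nat.cast_ne_zero.2 (Nat.choose_pos hk).ne'
  refine ⟨((t₁.choose j : K) * t₂.choose k)⁻¹ • ψ₂, fun h => ?_⟩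
  rw [LinearMap.smul_apply, h2, smul_eq_mul]
  field_simp

/-- Functions on `H` that are bihomogeneous polynomials in the first columns. -/
def bihom (K : Type*) [Field K] (i j : ℕ) : Submodule K (GL2xGL2 K → K) :=
  Submodule.span K {f | ∃ p q r s : ℕ, p + q = i ∧ r + s = j ∧
    f = fun h => fst h 0 0 ^ p * fst h 1 0 ^ q * (snd h 0 0 ^ r * snd h 1 0 ^ s)}

theorem bihom_mul {i j k l : ℕ} {f g : GL2xGL2 K → K} (hf : f ∈ bihom K i j)
    (hg : g ∈ bihom K k l) : f * g ∈ bihom K (i + k) (j + l) := by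
  have h := Submodule.mul_mem_mul hf hg
  rw [bihom, bihom, Submodule.span_mul_span] at h
  refine Submodule.span_mono ?_ h
  rintro _ ⟨_, ⟨p, q, r, s, rfl, rfl, rfl⟩, _, ⟨p', q', r', s', rfl, rfl, rfl⟩, rfl⟩
  refine ⟨p + p', q + q', r + r', s + s', by ring, by ring, ?_⟩
  funext h
  simp only [Pi.mul_apply]
  ring

theorem bihom_pow {i j : ℕ} {f : GL2xGL2 K → K} (hf : f ∈ bihom K i j) (n : ℕ) :
    f ^ n ∈ bihom K (n * i) (n * j) := by
  induction n with
  | zero => exact Submodule.subset_span ⟨0, 0, 0, 0, by simp, by simp, by funext; simp⟩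
  | succ n ih =>
    rw [pow_succ, add_mul, add_mul, one_mul, one_mul]
    exact bihom_mul ih hf

theorem fst_linear_mem_bihom (x y : K) :
    (fun h : GL2xGL2 K => fst h 0 0 * x - fst h 1 0 * y) ∈ bihom K 1 0 := by
  have h1 : (fun h : GL2xGL2 K => fst h 0 0) ∈ bihom K 1 0 :=
    Submodule.subset_span ⟨1, 0, 0, 0, by simp, by simp, by funext; simp⟩
  have h2 : (fun h : GL2xGL2 K => fst h 1 0) ∈ bihom K 1 0 :=
    Submodule.subset_span ⟨0, 1, 0, 0, by simp, by simp, by funext; simp⟩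
  convert sub_mem (Submodule.smul_mem _ x h1) (Submodule.smul_mem _ y h2) using 1
  funext h
  simp [mul_comm]

theorem snd_linear_mem_bihom (x y : K) :
    (fun h : GL2xGL2 K => snd h 0 0 * x - snd h 1 0 * y) ∈ bihom K 0 1 := by
  have h1 : (fun h : GL2xGL2 K => snd h 0 0) ∈ bihom K 0 1 :=
    Submodule.subset_span ⟨0, 0, 1, 0, by simp, by simp, by funext; simp⟩
  have h2 : (fun h : GL2xGL2 K => snd h 1 0) ∈ bihom K 0 1 :=
    Submodule.subset_span ⟨0, 0, 0, 1, by simp, by simp, by funext; simp⟩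
  convert sub_mem (Submodule.smul_mem _ x h1) (Submodule.smul_mem _ y h2) using 1
  funext h
  simp [mul_comm]

/-- The map from functionals to matrix coefficients of a vector. -/
def coeffMap (σ : Representation K (GL2xGL2 K) W) (w : W) :
    (W →ₗ[K] K) →ₗ[K] (GL2xGL2 K → K) where
  toFun ψ h := ψ (σ h w)
  map_add' _ _ := rfl
  map_smul' _ _ := rfl

theorem bihom_le_range_coeffMap [CharZero K] (ha : IsAlgebraicRep coord σ) (hw0 : w ≠ 0)
    (hw : ∀ b : GL2xGL2 K, (b.1.1 : Matrix (Fin 2) (Fin 2) K).BlockTriangular id →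
      (b.1.2 : Matrix (Fin 2) (Fin 2) K).BlockTriangular id →
        σ b w = ((b.1.1 : Matrix (Fin 2) (Fin 2) K) 0 0 ^ t₁
          * (b.1.2 : Matrix (Fin 2) (Fin 2) K) 0 0 ^ t₂) • w) :
    bihom K t₁ t₂ ≤ LinearMap.range (coeffMap σ w) := by
  refine Submodule.span_le.2 ?_
  rintro _ ⟨p, q, r, s, rfl, rfl, rfl⟩
  obtain ⟨ψ, hψ⟩ := exists_monomial_functional ha hw0 hw (Nat.le_add_left q p)
    (Nat.le_add_left s r)
  refine ⟨ψ, funext fun h => ?_⟩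
  change ψ (σ h w) = _
  simpa using hψ h

theorem coeffMap_injective (hi : σ.IsIrreducible) (hw0 : w ≠ 0) :
    Function.Injective (coeffMap σ w) := by
  intro ψ ψ' h
  exact LinearMap.ext_on_range (hi.span_orbit_eq_top hw0) fun g => congrFun h g

/-- Left translates of a product of semi-invariants are bihomogeneous in the first columns. -/
theorem semiInv_translate_mem_bihom (nA nB nC nD : ℕ) (g : GSp4 K) :
    (fun h : GL2xGL2 K => (fst h).det ^ (nA + nB + 2 * nC + nD) *
      GSp4.semiInv nA nB nC nD (iota K h⁻¹ * g)) ∈ bihom K (nA + nC) (nB + nC) := by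
  let X : Fin 4 → GL2xGL2 K → K := fun j h =>
    fst h 0 0 * GSp4.mat g 3 j - fst h 1 0 * GSp4.mat g 0 j
  let Y : Fin 4 → GL2xGL2 K → K := fun j h =>
    snd h 0 0 * GSp4.mat g 2 j - snd h 1 0 * GSp4.mat g 1 j
  have hX : ∀ j, X j ∈ bihom K 1 0 := fun _ => fst_linear_mem_bihom _ _
  have hY : ∀ j, Y j ∈ bihom K 0 1 := fun _ => snd_linear_mem_bihom _ _
  -- By the adjugate formula, rows 3 and 2 of `iota h⁻¹ * g` are `X / det` and `Y / det`, so this is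
  -- `det²` times the minor `23`.
  have hP : Y 0 * X 1 - X 0 * Y 1 ∈ bihom K 1 1 := by
    have h := sub_mem (bihom_mul (hX 1) (hY 0)) (bihom_mul (hX 0) (hY 1))
    rwa [mul_comm (X 1), add_zero, zero_add] at h
  have hm := Submodule.smul_mem _ (GSp4.minor g 0 3 ^ nD)
    (bihom_mul (bihom_mul (bihom_pow (hX 0) nA) (bihom_pow (hY 0) nB)) (bihom_pow hP nC))
  simp only [mul_one, mul_zero, add_zero, zero_add] at hm
  convert hm using 1
  funext h
  have hd := det_fst_ne_zero h
  have e3 : ∀ j, GSp4.mat (iota K h⁻¹ * g) 3 j = X j h / (fst h).det := fun j => by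
    rw [GSp4.mat_mul, mat_iota]
    change (iotaMat (fst h⁻¹) (snd h⁻¹) * GSp4.mat g) 3 j = _
    rw [fst_inv, snd_inv]
    simp [iotaMat, Matrix.mul_apply, Fin.sum_univ_succ, X]
    ring
  have e2 : ∀ j, GSp4.mat (iota K h⁻¹ * g) 2 j = Y j h / (fst h).det := fun j => by
    rw [GSp4.mat_mul, mat_iota]
    change (iotaMat (fst h⁻¹) (snd h⁻¹) * GSp4.mat g) 2 j = _
    rw [fst_inv, snd_inv]
    simp [iotaMat, Matrix.mul_apply, Fin.sum_univ_succ, Y]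
    ring
  have e0 : ∀ j, GSp4.mat (iota K h⁻¹ * g) 0 j =
      (fst h 1 1 * GSp4.mat g 0 j - fst h 0 1 * GSp4.mat g 3 j) / (fst h).det := fun j => by
    rw [GSp4.mat_mul, mat_iota]
    change (iotaMat (fst h⁻¹) (snd h⁻¹) * GSp4.mat g) 0 j = _
    rw [fst_inv, snd_inv]
    simp [iotaMat, Matrix.mul_apply, Fin.sum_univ_succ]
    ring
  have m23 : GSp4.minor (iota K h⁻¹ * g) 2 3 = (Y 0 * X 1 - X 0 * Y 1) h / (fst h).det ^ 2 := by
    rw [GSp4.minor, e2, e3, e2, e3]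
    simp only [Pi.mul_apply, Pi.sub_apply]
    field_simp
  -- Rows 0 and 3 form the block of the first component, so this minor only scales by the inverse
  -- determinant and contributes no degree in the first columns.
  have m03 : GSp4.minor (iota K h⁻¹ * g) 0 3 = GSp4.minor g 0 3 / (fst h).det := by
    rw [GSp4.minor, e0, e3, e0, e3, GSp4.minor]
    field_simp
    rw [det_fin_two]
    simp only [X]
    ring
  rw [GSp4.semiInv, e3, e2, m23, m03]
  simp only [Pi.smul_apply, Pi.mul_apply, Pi.pow_apply, smul_eq_mul]
  generalize (Y 0 * X 1 - X 0 * Y 1) h = P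
  simp only [div_pow, pow_add, pow_mul]
  field_simp

end GL2xGL2

/-! ### Invariant functionals on the tensor product versus semi-invariant functionals. -/

open scoped TensorProduct

namespace GL2xGL2

variable {K : Type*} [Field K] {VG VH : Type*} [AddCommGroup VG] [Module K VG]
  [AddCommGroup VH] [Module K VH]

@[simp] theorem detPow_apply (n : ℤ) (h : GL2xGL2 K) (x : K) :
    detPow K n h x = (fst h).det ^ n * x := by
  simp [detPow, fst]

theorem detPow_tprod_apply (ρ : Representation K (GSp4 K) VG) (σ : Representation K (GL2xGL2 K) VH)
    (n : ℤ) (h : GL2xGL2 K) (x : VG) (y : VH) (z : K) :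
    (Representation.tprod (ρ.comp (iota K)) σ).tprod (detPow K n) h ((x ⊗ₜ y) ⊗ₜ z) =
      ((ρ (iota K h) x) ⊗ₜ[K] (σ h y)) ⊗ₜ[K] ((fst h).det ^ n * z) := by
  simp

theorem det_eq_of_blockTriangular {A : Matrix (Fin 2) (Fin 2) K} (h : A.BlockTriangular id) :
    A.det = A 0 0 * A 1 1 := by
  have : A 1 0 = 0 := h (by simp)
  rw [det_fin_two, this]; ring

/-- An invariant functional restricts to a semi-invariant functional. -/
theorem exists_semiinvariant_of_intertwining {ρ : Representation K (GSp4 K) VG}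
    {σ : Representation K (GL2xGL2 K) VH} {t₁ t₂ : ℕ} {w : VH} (hi : σ.IsIrreducible) (hw0 : w ≠ 0)
    (hw : ∀ b : GL2xGL2 K, (b.1.1 : Matrix (Fin 2) (Fin 2) K).BlockTriangular id →
      (b.1.2 : Matrix (Fin 2) (Fin 2) K).BlockTriangular id →
        σ b w = ((b.1.1 : Matrix (Fin 2) (Fin 2) K) 0 0 ^ t₁
          * (b.1.2 : Matrix (Fin 2) (Fin 2) K) 0 0 ^ t₂) • w) {n : ℤ}
    {f : Representation.IntertwiningMap ((Representation.tprod (ρ.comp (iota K)) σ).tprod (detPow K n))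
      (Representation.trivial K (GL2xGL2 K) K)} (hf : f ≠ 0) :
    ∃ φ : VG →ₗ[K] K, φ ≠ 0 ∧
      ∀ h : GL2xGL2 K, (h.1.1 : Matrix (Fin 2) (Fin 2) K).BlockTriangular id →
      (h.1.2 : Matrix (Fin 2) (Fin 2) K).BlockTriangular id → ∀ x, φ (ρ (iota K h) x) =
        ((h.1.1 : Matrix (Fin 2) (Fin 2) K) 1 1 ^ t₁ * (h.1.2 : Matrix (Fin 2) (Fin 2) K) 1 1 ^ t₂
          * (h.1.1 : Matrix (Fin 2) (Fin 2) K).det ^ (-n - t₁ - t₂)) * φ x := by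
  have hinv : ∀ h x y z, f (((ρ (iota K h) x) ⊗ₜ[K] (σ h y)) ⊗ₜ[K] ((fst h).det ^ n * z)) =
      f ((x ⊗ₜ y) ⊗ₜ z) := fun h x y z => by
    rw [← detPow_tprod_apply, f.isIntertwining, Representation.trivial_apply]
  let φ : VG →ₗ[K] K := f.toLinearMap ∘ₗ (TensorProduct.mk K (VG ⊗[K] VH) K).flip 1 ∘ₗ
    (TensorProduct.mk K VG VH).flip w
  have hφ : ∀ x, φ x = f ((x ⊗ₜ w) ⊗ₜ 1) := fun _ => rfl
  have hscal : ∀ (t : VG ⊗[K] VH) (z : K), f (t ⊗ₜ z) = z * f (t ⊗ₜ 1) := fun t z => by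
    rw [← smul_eq_mul, ← map_smul, ← TensorProduct.tmul_smul, smul_eq_mul, mul_one]
  refine ⟨φ, fun h0 => hf ?_, fun h h1 h2 x => ?_⟩
  · refine Representation.IntertwiningMap.ext (TensorProduct.ext_threefold fun x y z => ?_)
    change f ((x ⊗ₜ y) ⊗ₜ z) = 0
    have hlin : f.toLinearMap ∘ₗ (TensorProduct.mk K (VG ⊗[K] VH) K).flip z ∘ₗ
        TensorProduct.mk K VG VH x = 0 := by
      -- Invariance moves `h` from the vector `σ h w` to the first factor, so vanishing at `w`
      -- implies vanishing on the orbit of `w`, which spans.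
      refine LinearMap.ext_on_range (hi.span_orbit_eq_top hw0) fun h => ?_
      have e := hinv h (ρ (iota K h)⁻¹ x) w (((fst h).det ^ n)⁻¹ * z)
      rw [← Module.End.mul_apply, ← map_mul, mul_inv_cancel, map_one, Module.End.one_apply,
        mul_inv_cancel_left₀ (zpow_ne_zero n (det_fst_ne_zero h)), hscal _ (_ * z), ← hφ, h0] at e
      simpa using e
    exact LinearMap.congr_fun hlin y
  · have hd := det_fst_ne_zero h
    have d1 : (fst h).det = fst h 0 0 * fst h 1 1 := det_eq_of_blockTriangular h1
    have d2 : (fst h).det = snd h 0 0 * snd h 1 1 :=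
      (det_snd h).symm.trans (det_eq_of_blockTriangular h2)
    have e := hinv h x w 1
    rw [hw h h1 h2, TensorProduct.tmul_smul, ← TensorProduct.smul_tmul', map_smul, hscal, mul_one,
      ← hφ, ← hφ] at e
    rw [← e]
    change _ = (fst h 1 1 ^ t₁ * snd h 1 1 ^ t₂ * (fst h).det ^ (-n - t₁ - t₂)) *
      ((fst h 0 0 ^ t₁ * snd h 0 0 ^ t₂) * _)
    -- On triangular elements the upper left entries are `det` divided by the lower right ones; this
    -- is where the exponent `-n - t₁ - t₂` comes from.
    have key : (fst h 1 1 ^ t₁ * snd h 1 1 ^ t₂ * (fst h).det ^ (-n - t₁ - t₂)) *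
      ((fst h 0 0 ^ t₁ * snd h 0 0 ^ t₂) * (fst h).det ^ n) = 1 := by
      calc _ = (fst h 0 0 * fst h 1 1) ^ t₁ * (snd h 0 0 * snd h 1 1) ^ t₂ *
            (fst h).det ^ (-n - t₁ - t₂) * (fst h).det ^ n := by ring
        _ = (fst h).det ^ ((t₁ : ℤ) + t₂ + (-n - t₁ - t₂) + n) := by
          rw [← d1, ← d2, zpow_add₀ hd, zpow_add₀ hd, zpow_add₀ hd, zpow_natCast, zpow_natCast]
        _ = 1 := by
          rw [show (t₁ : ℤ) + t₂ + (-n - t₁ - t₂) + n = 0 by ring, zpow_zero]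
    linear_combination (-φ (ρ (iota K h) x)) * key

/-- A functional whose matrix coefficient is a product of semi-invariants extends to an invariant
functional. -/
theorem exists_intertwining [CharZero K] {ρ : Representation K (GSp4 K) VG} {v : VG}
    (hiG : ρ.IsIrreducible) (hv0 : v ≠ 0)
    {σ : Representation K (GL2xGL2 K) VH} (ha : IsAlgebraicRep coord σ) {nA nB nC nD : ℕ} {w : VH}
    (hi : σ.IsIrreducible) (hw0 : w ≠ 0)
    (hw : ∀ b : GL2xGL2 K, (b.1.1 : Matrix (Fin 2) (Fin 2) K).BlockTriangular id →
      (b.1.2 : Matrix (Fin 2) (Fin 2) K).BlockTriangular id →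
        σ b w = ((b.1.1 : Matrix (Fin 2) (Fin 2) K) 0 0 ^ (nA + nC)
          * (b.1.2 : Matrix (Fin 2) (Fin 2) K) 0 0 ^ (nB + nC)) • w)
    {φ : VG →ₗ[K] K} (hφ : ∀ g, φ (ρ g v) = GSp4.semiInv nA nB nC nD g) {n : ℤ}
    (hn : n = -((nA + nB + 2 * nC + nD : ℕ) : ℤ)) :
    ∃ f : Representation.IntertwiningMap ((Representation.tprod (ρ.comp (iota K)) σ).tprod (detPow K n))
      (Representation.trivial K (GL2xGL2 K) K), f ≠ 0 := by
  let N := nA + nB + 2 * nC + nD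
  let T : VG →ₗ[K] (GL2xGL2 K → K) :=
    { toFun := fun x h => (fst h).det ^ N * φ (ρ (iota K h⁻¹) x)
      map_add' := fun x y => by funext h; simp [mul_add]
      map_smul' := fun c x => by funext h; simp; ring }
  have hT : ∀ x, T x ∈ LinearMap.range (coeffMap σ w) := by
    intro x
    refine bihom_le_range_coeffMap ha hw0 hw ?_
    have hx : x ∈ Submodule.span K (Set.range fun g => ρ g v) :=
      hiG.span_orbit_eq_top hv0 ▸ Submodule.mem_top
    induction hx using Submodule.span_induction with
    | mem x hx =>
      obtain ⟨g, rfl⟩ := hx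
      convert semiInv_translate_mem_bihom nA nB nC nD g using 1
      funext h
      rw [← hφ, map_mul]
      rfl
    | zero => rw [map_zero]; exact zero_mem _
    | add x y _ _ hx hy => rw [map_add]; exact add_mem hx hy
    | smul c x _ hx => rw [map_smul]; exact Submodule.smul_mem _ _ hx
  -- Frobenius reciprocity: each function `T x` is the matrix coefficient along `w` of a unique
  -- functional on `VH`, so `T` lifts to a map into the dual, equivariant up to `det ^ N`.
  let Ψ : VG →ₗ[K] (VH →ₗ[K] K) :=
    (LinearEquiv.ofInjective (coeffMap σ w) (coeffMap_injective hi hw0)).symm.toLinearMap ∘ₗ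
      T.codRestrict _ hT
  have hΨ : ∀ x h, Ψ x (σ h w) = (fst h).det ^ N * φ (ρ (iota K h⁻¹) x) := by
    intro x h
    have : coeffMap σ w (Ψ x) = T x := by
      have := (LinearEquiv.ofInjective (coeffMap σ w) (coeffMap_injective hi hw0)).apply_symm_apply
        (T.codRestrict _ hT x)
      exact congrArg Subtype.val this
    exact congrFun this h
  have hequiv : ∀ h x y, Ψ (ρ (iota K h) x) (σ h y) = (fst h).det ^ N * Ψ x y := by
    intro h x
    refine LinearMap.congr_fun (f := (Ψ (ρ (iota K h) x)) ∘ₗ σ h)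
      (g := (fst h).det ^ N • Ψ x) ?_
    refine LinearMap.ext_on_range (hi.span_orbit_eq_top hw0) fun k => ?_
    rw [LinearMap.comp_apply, LinearMap.smul_apply, ← Module.End.mul_apply, ← map_mul, hΨ, hΨ,
      ← Module.End.mul_apply, ← map_mul, ← map_mul, _root_.mul_inv_rev, inv_mul_cancel_right, fst_mul,
      det_mul, mul_pow, smul_eq_mul, mul_assoc]
  let F : (VG ⊗[K] VH) ⊗[K] K →ₗ[K] K :=
    TensorProduct.lift Ψ ∘ₗ (TensorProduct.rid K (VG ⊗[K] VH)).toLinearMap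
  have hF : ∀ x y z, F ((x ⊗ₜ y) ⊗ₜ z) = z * Ψ x y := fun x y z => by simp [F]
  refine ⟨⟨F, fun h => ?_⟩, fun h0 => ?_⟩
  · refine TensorProduct.ext_threefold fun x y z => ?_
    change F ((Representation.tprod (Representation.tprod (ρ.comp (iota K)) σ) (detPow K n)) h
      ((x ⊗ₜ y) ⊗ₜ z)) = F ((x ⊗ₜ y) ⊗ₜ z)
    rw [detPow_tprod_apply, hF, hequiv, hF, hn, _root_.zpow_neg, zpow_natCast]
    have hN : (fst h).det ^ N ≠ 0 := pow_ne_zero N (det_fst_ne_zero h)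
    change ((fst h).det ^ N)⁻¹ * z * ((fst h).det ^ N * Ψ x y) = _
    field_simp
  · have h1 : F ((ρ (GSp4.low 0 1 1 0) v ⊗ₜ σ 1 w) ⊗ₜ 1) = 0 :=
      congrArg (fun f : Representation.IntertwiningMap _ _ => f.toLinearMap _) h0
    rw [hF, hΨ, inv_one, map_one, map_one, Module.End.one_apply, hφ] at h1
    simp [GSp4.semiInv, GSp4.minor, GSp4.lowMat] at h1

end GL2xGL2

theorem mainTheorem8 {K : Type*} [Field K] [CharZero K]
    (r₁ r₂ t₁ t₂ : ℕ) (hr : r₂ ≤ r₁)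
    (k₁ k₂ c₁ c₂ w : ℤ)
    (hk₁ : k₁ = r₁ + 3) (hk₂ : k₂ = r₂ + 3) (hc₁ : c₁ = t₁ + 2) (hc₂ : c₂ = t₂ + 2)
    (hw : 2 * w = k₁ + k₂ + c₁ + c₂ - 6)
    {VG : Type*} [AddCommGroup VG] [Module K VG] (ρ : Representation K (GSp4 K) VG)
    (hρ : GSp4.IsHighestWeightRep ρ r₁ r₂)
    {VH : Type*} [AddCommGroup VH] [Module K VH] (σ : Representation K (GL2xGL2 K) VH)
    (hσ : GL2xGL2.IsHighestWeightRep σ t₁ t₂) :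
    (∃ f : Representation.IntertwiningMap
        ((Representation.tprod (ρ.comp (iota K)) σ).tprod (GL2xGL2.detPow K (2 - w)))
        (Representation.trivial K (GL2xGL2 K) K), f ≠ 0) ↔
      RegionE k₁ k₂ c₁ c₂ := by
  obtain ⟨haG, hiG, v, hv0, hv⟩ := hρ
  obtain ⟨haH, hiH, u, hu0, hu⟩ := hσ
  constructor
  · rintro ⟨f, hf⟩
    obtain ⟨φ, hφ0, hφ⟩ := GL2xGL2.exists_semiinvariant_of_intertwining hiH hu0 hu hf
    obtain ⟨h1, h2, h3, h4⟩ := GSp4.weight_of_semiinvariant haG hiG hv0 hv hφ0 hφ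
    refine ⟨abs_le.2 ⟨?_, ?_⟩, ?_, ?_⟩ <;> omega
  · rintro ⟨h1, h2, h3⟩
    obtain ⟨h4, h5⟩ := abs_le.1 h1
    -- Solve for the exponents: `nD = (r₁ + r₂ - t₁ - t₂) / 2` and the others follow from `r₂`,
    -- `t₁`, `t₂`. Each inequality of region (e) is the nonnegativity of one exponent.
    obtain ⟨nD, hD⟩ := Int.eq_ofNat_of_zero_le (a := w - 2 - t₁ - t₂) (by omega)
    obtain ⟨nC, hC⟩ := Int.eq_ofNat_of_zero_le (a := r₂ - nD) (by omega)
    obtain ⟨nA, hA⟩ := Int.eq_ofNat_of_zero_le (a := t₁ - nC) (by omega)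
    obtain ⟨nB, hB⟩ := Int.eq_ofNat_of_zero_le (a := t₂ - nC) (by omega)
    obtain rfl : t₁ = nA + nC := by omega
    obtain rfl : t₂ = nB + nC := by omega
    obtain ⟨φ, hφ⟩ := GSp4.exists_semiInv_functional haG hv0 hv (nA := nA) (nB := nB) (nC := nC)
      (nD := nD) (by omega) (by omega)
    exact GL2xGL2.exists_intertwining hiG hv0 haH hiH hu0 hu hφ (by push_cast; omega)
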